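/- Let $M$ be a smooth manifold (finite-dimensional, Hausdorff, second countable, not necessarily connected), and let $\mathfrak{K}\to M$ be a smooth locally trivial bundle of finite-dimensional real Lie algebras with semisimple fibres $\mathfrak{K}_x$; the isomorphism class of the fibre may depend on the connected component. Let $$\widehat M=\{(x,I)\;;\;x\in M,\ I \text{ a maximal ideal of } \mathfrak{K}_x\},\qquad \mathrm{pr}\colon \widehat M\to M,\quad \mathrm{pr}(x,I)=x .$$ Then $\widehat M$ can be given the structure of a (Hausdorff, second countable, possibly disconnected) smooth manifold such that $\mathrm{pr}$ is a covering map with finite fibres and a local diffeomorphism. The fibre $\mathrm{pr}^{-1}(x)$ is non-empty whenever $\mathfrak{K}_x\neq 0$. Moreover there is a smooth locally trivial bundle of Lie algebras $\widehat{\mathfrak{K}}\to\widehat M$ with fibres $\widehat{\mathfrak{K}}_{(x,I)}=\mathfrak{K}_x/I$, all of which are simple, such that $$\Phi(\sigma)(x,I)=\sigma(x)+I$$ defines isomorphisms of locally convex Lie algebras (that is, isomorphisms of Lie algebras that are homeomorphisms) $\Gamma(\mathfrak{K})\cong\Gamma(\widehat{\mathfrak{K}})$ and $\Gamma_c(\mathfrak{K})\cong\Gamma_c(\widehat{\mathfrak{K}})$.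 Here $\Gamma$ denotes the Lie algebra of smooth sections with pointwise bracket and the topology of uniform convergence of all derivatives on compact sets (in charts and local trivialisations), and $\Gamma_c$ denotes the Lie algebra of smooth sections with compact support with its LF topology, i.e. the locally convex inductive limit over compact $K$ of the spaces $\Gamma_K$ of sections supported in $K$. -/

import Mathlib

open scoped Manifold ContDiff Topology

universe u v w

noncomputable section

/-! ### Lie algebra bundles

Mathlib's vector bundles have one model fibre for the whole base. Here the isomorphism class, and
even the dimension, of the fibre may change from one connected component of the base to another,
so bundles are given by a smooth atlas of local trivialisations, each with a model Lie algebra of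
its own. -/

/-- A fibrewise trivialisation, over an open subset of `M`, of a family of real Lie algebras
`V x`, `x : M`: isomorphisms of Lie algebras between the `V x`, `x ∈ baseSet`, and one
finite-dimensional real Lie algebra `model`. (Outside `baseSet` the maps are arbitrary.) -/
structure LieTrivialization {M : Type u} [TopologicalSpace M] (V : M → Type v)
    [∀ x, LieRing (V x)] [∀ x, LieAlgebra ℝ (V x)] where
  /-- The domain of the trivialisation. -/
  baseSet : Set M
  isOpen_baseSet : IsOpen baseSet
  /-- The model Lie algebra. -/
  model : Type v
  [lieRing : LieRing model]
  [lieAlgebra : LieAlgebra ℝ model]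
  [finiteDimensional : FiniteDimensional ℝ model]
  /-- The isomorphism from the fibre to the model. -/
  toModel : ∀ x, V x →ₗ⁅ℝ⁆ model
  /-- The isomorphism from the model to the fibre. -/
  ofModel : ∀ x, model →ₗ⁅ℝ⁆ V x
  ofModel_toModel : ∀ x ∈ baseSet, ∀ a : V x, ofModel x (toModel x a) = a
  toModel_ofModel : ∀ x ∈ baseSet, ∀ b : model, toModel x (ofModel x b) = b

attribute [instance] LieTrivialization.lieRing LieTrivialization.lieAlgebra
  LieTrivialization.finiteDimensional

/-- A smooth locally trivial bundle of finite-dimensional real Lie algebras over `M` (a smooth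
manifold modelled on `E`) with fibres `V x`: an atlas of local trivialisations covering `M` whose
transition maps are smooth. A map into a finite-dimensional real vector space is smooth
iff all its compositions with linear functionals are, so smoothness of the transition map
`x ↦ e'ₓ ∘ eₓ⁻¹`, with values in the linear maps `e.model → e'.model`, is expressed through its
matrix coefficients. -/
structure LieAlgebraBundle (E : Type w) [NormedAddCommGroup E] [NormedSpace ℝ E]
    {M : Type u} [TopologicalSpace M] [ChartedSpace E M] (V : M → Type v)
    [∀ x, LieRing (V x)] [∀ x, LieAlgebra ℝ (V x)] where
  /-- The local trivialisations. -/
  trivializations : Set (LieTrivialization V)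
  exists_mem_baseSet : ∀ x : M, ∃ e ∈ trivializations, x ∈ e.baseSet
  contMDiffOn_transition : ∀ e ∈ trivializations, ∀ e' ∈ trivializations,
    ∀ (b : e.model) (l : Module.Dual ℝ e'.model),
      ContMDiffOn 𝓘(ℝ, E) 𝓘(ℝ, ℝ) ∞ (fun x => l (e'.toModel x (e.ofModel x b)))
        (e.baseSet ∩ e'.baseSet)

namespace LieAlgebraBundle

variable {E : Type w} [NormedAddCommGroup E] [NormedSpace ℝ E]
  {M : Type u} [TopologicalSpace M] [ChartedSpace E M] {V : M → Type v}
  [∀ x, LieRing (V x)] [∀ x, LieAlgebra ℝ (V x)] (B : LieAlgebraBundle E V)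

/-! ### Smooth sections -/

/-- A section is smooth if it is smooth in every local trivialisation. -/
def IsSmoothSection (σ : ∀ x, V x) : Prop :=
  ∀ e ∈ B.trivializations, ∀ l : Module.Dual ℝ e.model,
    ContMDiffOn 𝓘(ℝ, E) 𝓘(ℝ, ℝ) ∞ (fun x => l (e.toModel x (σ x))) e.baseSet

/-- The vector space of smooth sections. -/
def smoothSections : Submodule ℝ (∀ x, V x) where
  carrier := {σ | B.IsSmoothSection σ}
  add_mem' {σ τ} hσ hτ e he l := by
    refine ((hσ e he l).add (hτ e he l)).congr fun x _ => ?_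
    simp
  zero_mem' e he l := by simpa using contMDiffOn_const
  smul_mem' c σ hσ e he l := by
    refine ((contMDiffOn_const (c := c)).mul (hσ e he l)).congr fun x _ => ?_
    simp

theorem IsSmoothSection.lie {σ τ : ∀ x, V x} (hσ : B.IsSmoothSection σ)
    (hτ : B.IsSmoothSection τ) : B.IsSmoothSection (fun x => ⁅σ x, τ x⁆) := by
  intro e he l
  let b := Module.finBasis ℝ e.model
  have key : ∀ x, l (e.toModel x ⁅σ x, τ x⁆) = ∑ i, ∑ j,
      (b.coord i (e.toModel x (σ x)) * b.coord j (e.toModel x (τ x))) * l ⁅b i, b j⁆ := by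
    intro x
    rw [LieHom.map_lie]
    generalize e.toModel x (σ x) = a
    generalize e.toModel x (τ x) = c
    conv_lhs => rw [← b.sum_repr a, ← b.sum_repr c]
    simp only [sum_lie, lie_sum, smul_lie, lie_smul, map_sum, map_smul, smul_eq_mul,
      Module.Basis.coord_apply, Finset.mul_sum]
    rw [Finset.sum_comm]
    exact Finset.sum_congr rfl fun i _ => Finset.sum_congr rfl fun j _ => by ring
  simp only [key]
  refine contMDiffOn_finsetSum fun i _ => contMDiffOn_finsetSum fun j _ => ?_
  exact ((hσ e he _).mul (hτ e he _)).mul contMDiffOn_const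

/-- The gauge algebra `Γ`: smooth sections, with the pointwise Lie bracket. -/
def SmoothSection : Type _ := B.smoothSections

namespace SmoothSection

variable {B}

instance : AddCommGroup B.SmoothSection := inferInstanceAs (AddCommGroup B.smoothSections)

instance : Module ℝ B.SmoothSection := inferInstanceAs (Module ℝ B.smoothSections)

instance : CoeFun B.SmoothSection (fun _ => ∀ x, V x) := ⟨fun σ => σ.1⟩

theorem isSmooth (σ : B.SmoothSection) : B.IsSmoothSection σ := σ.2

@[ext] theorem ext {σ τ : B.SmoothSection} (h : ∀ x, σ x = τ x) : σ = τ :=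
  Subtype.ext (funext h)

@[simp] theorem add_apply (σ τ : B.SmoothSection) (x : M) : (σ + τ) x = σ x + τ x := rfl

@[simp] theorem zero_apply (x : M) : (0 : B.SmoothSection) x = 0 := rfl

@[simp] theorem smul_apply (c : ℝ) (σ : B.SmoothSection) (x : M) : (c • σ) x = c • σ x := rfl

instance : Bracket B.SmoothSection B.SmoothSection :=
  ⟨fun σ τ => ⟨fun x => ⁅σ x, τ x⁆, σ.isSmooth.lie B τ.isSmooth⟩⟩

@[simp] theorem lie_apply (σ τ : B.SmoothSection) (x : M) : ⁅σ, τ⁆ x = ⁅σ x, τ x⁆ := rfl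

instance : LieRing B.SmoothSection where
  add_lie σ τ ρ := by ext x; simp
  lie_add σ τ ρ := by ext x; simp
  lie_self σ := by ext x; simp
  leibniz_lie σ τ ρ := by ext x; simp

instance : LieAlgebra ℝ B.SmoothSection where
  lie_smul c σ τ := by ext x; simp

end SmoothSection

/-! ### The `C^∞`-topology on smooth sections -/

/-- The coordinate expression, through the component `l` of a trivialisation `e` and a chart `φ`
of `M`, of a section. -/
def localRep (e : LieTrivialization V) (l : Module.Dual ℝ e.model)
    (φ : OpenPartialHomeomorph M E) (σ : ∀ x, V x) : E → ℝ :=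
  fun y => l (e.toModel (φ.symm y) (σ (φ.symm y)))

/-- The data indexing the seminorms: a trivialisation `e`, a chart `φ`, a compact set contained in
both of their domains, an order of differentiation, and a linear functional on the model fibre. -/
structure SeminormIndex where
  /-- a local trivialisation of the bundle -/
  e : LieTrivialization V
  he : e ∈ B.trivializations
  /-- a chart of the base -/
  φ : OpenPartialHomeomorph M E
  hφ : φ ∈ atlas E M
  /-- a compact set -/
  K : Set M
  isCompact_K : IsCompact K
  K_subset_source : K ⊆ φ.source
  K_subset_baseSet : K ⊆ e.baseSet
  /-- an order of differentiation -/
  n : ℕ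
  /-- a linear functional on the model fibre -/
  l : Module.Dual ℝ e.model

variable {B}

theorem SeminormIndex.contDiffOn [IsManifold 𝓘(ℝ, E) ∞ M] (i : B.SeminormIndex)
    (σ : B.SmoothSection) : ContDiffOn ℝ ∞ (localRep i.e i.l i.φ σ)
      (i.φ.target ∩ i.φ.symm ⁻¹' i.e.baseSet) := by
  rw [← contMDiffOn_iff_contDiffOn]
  have h1 : ContMDiffOn 𝓘(ℝ, E) 𝓘(ℝ, E) ∞ i.φ.symm i.φ.target :=
    contMDiffOn_symm_of_mem_maximalAtlas (IsManifold.subset_maximalAtlas i.hφ)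
  exact (σ.isSmooth i.e i.he i.l).comp (h1.mono Set.inter_subset_left) fun y hy => hy.2

theorem SeminormIndex.isOpen (i : B.SeminormIndex) :
    IsOpen (i.φ.target ∩ i.φ.symm ⁻¹' i.e.baseSet) :=
  i.φ.symm.isOpen_inter_preimage i.e.isOpen_baseSet

theorem SeminormIndex.mem (i : B.SeminormIndex) {x : M} (hx : x ∈ i.K) :
    i.φ x ∈ i.φ.target ∩ i.φ.symm ⁻¹' i.e.baseSet := by
  refine ⟨i.φ.map_source (i.K_subset_source hx), ?_⟩
  simpa [i.φ.left_inv (i.K_subset_source hx)] using i.K_subset_baseSet hx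

theorem SeminormIndex.contDiffAt [IsManifold 𝓘(ℝ, E) ∞ M] (i : B.SeminormIndex)
    (σ : B.SmoothSection) {x : M} (hx : x ∈ i.K) :
    ContDiffAt ℝ ∞ (localRep i.e i.l i.φ σ) (i.φ x) :=
  (i.contDiffOn σ).contDiffAt (i.isOpen.mem_nhds (i.mem hx))

theorem SeminormIndex.bddAbove [IsManifold 𝓘(ℝ, E) ∞ M] (i : B.SeminormIndex)
    (σ : B.SmoothSection) : BddAbove (Set.range fun x : i.K =>
      ‖iteratedFDeriv ℝ i.n (localRep i.e i.l i.φ σ) (i.φ x)‖) := by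
  have hc : ContinuousOn (fun x => ‖iteratedFDeriv ℝ i.n (localRep i.e i.l i.φ σ) (i.φ x)‖)
      i.K := by
    intro x hx
    have h1 : ContinuousAt (iteratedFDeriv ℝ i.n (localRep i.e i.l i.φ σ)) (i.φ x) :=
      ((i.contDiffAt σ hx).iteratedFDeriv_right (m := 0) (i := i.n)
        (by simpa using (by exact_mod_cast le_top : ((i.n : ℕ∞) : WithTop ℕ∞) ≤ ∞))).continuousAt
    have h2 : ContinuousAt i.φ x := i.φ.continuousAt (i.K_subset_source hx)
    exact (ContinuousAt.comp (f := i.φ) h1 h2).norm.continuousWithinAt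
  have := (i.isCompact_K.image_of_continuousOn hc).bddAbove
  rwa [Set.image_eq_range] at this

/-- The seminorm `σ ↦ sup_{x ∈ K} ‖Dⁿ (l ∘ e ∘ σ ∘ φ⁻¹) (φ x)‖`. -/
def SeminormIndex.seminorm [IsManifold 𝓘(ℝ, E) ∞ M] (i : B.SeminormIndex) :
    Seminorm ℝ B.SmoothSection :=
  Seminorm.ofSMulLE
    (fun σ => ⨆ x : i.K, ‖iteratedFDeriv ℝ i.n (localRep i.e i.l i.φ σ) (i.φ x)‖)
    (by
      have : localRep i.e i.l i.φ (fun x => (0 : B.SmoothSection) x) = fun _ => (0 : ℝ) := by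
        funext y; simp [localRep]
      simp [this])
    (by
      intro σ τ
      refine Real.iSup_le (fun x => ?_) (add_nonneg (Real.iSup_nonneg fun _ => norm_nonneg _)
        (Real.iSup_nonneg fun _ => norm_nonneg _))
      have h : localRep i.e i.l i.φ (fun x => (σ + τ) x) =
          localRep i.e i.l i.φ σ + localRep i.e i.l i.φ τ := by
        funext y; simp [localRep]
      have hn : ((i.n : ℕ∞) : WithTop ℕ∞) ≤ ∞ := by exact_mod_cast le_top
      rw [h, iteratedFDeriv_add_apply ((i.contDiffAt σ x.2).of_le hn)
        ((i.contDiffAt τ x.2).of_le hn)]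
      exact (norm_add_le _ _).trans
        (add_le_add (le_ciSup (i.bddAbove σ) x) (le_ciSup (i.bddAbove τ) x)))
    (by
      intro c σ
      refine Real.iSup_le (fun x => ?_)
        (mul_nonneg (norm_nonneg _) (Real.iSup_nonneg fun _ => norm_nonneg _))
      have h : localRep i.e i.l i.φ (fun x => (c • σ) x) =
          c • localRep i.e i.l i.φ σ := by
        funext y; simp [localRep]
      have hn : ((i.n : ℕ∞) : WithTop ℕ∞) ≤ ∞ := by exact_mod_cast le_top
      rw [h, iteratedFDeriv_const_smul_apply ((i.contDiffAt σ x.2).of_le hn), norm_smul]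
      exact mul_le_mul_of_nonneg_left (le_ciSup (i.bddAbove σ) x) (norm_nonneg _))

theorem SeminormIndex.seminorm_apply [IsManifold 𝓘(ℝ, E) ∞ M] (i : B.SeminormIndex)
    (σ : B.SmoothSection) : i.seminorm σ =
      ⨆ x : i.K, ‖iteratedFDeriv ℝ i.n (localRep i.e i.l i.φ σ) (i.φ x)‖ := rfl

variable (B) in
/-- The family of seminorms defining the topology of `Γ`. -/
def sectionSeminorms [IsManifold 𝓘(ℝ, E) ∞ M] :
    SeminormFamily ℝ B.SmoothSection B.SeminormIndex :=
  fun i => i.seminorm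

namespace SmoothSection

/-- The topology of `Γ`: uniform convergence of all derivatives on compact sets, in charts and
local trivialisations. -/
instance [IsManifold 𝓘(ℝ, E) ∞ M] : TopologicalSpace B.SmoothSection :=
  B.sectionSeminorms.moduleFilterBasis.topology

theorem withSeminorms [IsManifold 𝓘(ℝ, E) ∞ M] : WithSeminorms B.sectionSeminorms := ⟨rfl⟩

instance [IsManifold 𝓘(ℝ, E) ∞ M] : IsTopologicalAddGroup B.SmoothSection :=
  withSeminorms.topologicalAddGroup

instance [IsManifold 𝓘(ℝ, E) ∞ M] : ContinuousSMul ℝ B.SmoothSection :=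
  withSeminorms.continuousSMul

instance [IsManifold 𝓘(ℝ, E) ∞ M] : LocallyConvexSpace ℝ B.SmoothSection :=
  withSeminorms.toLocallyConvexSpace

end SmoothSection

/-! ### Compactly supported smooth sections -/

variable (B) in
/-- The Lie subalgebra of smooth sections that vanish outside some compact set. -/
def compactlySupported : LieSubalgebra ℝ B.SmoothSection where
  carrier := {σ | ∃ K : Set M, IsCompact K ∧ ∀ x ∉ K, σ x = 0}
  add_mem' := by
    rintro σ τ ⟨K, hK, h⟩ ⟨L, hL, h'⟩
    refine ⟨K ∪ L, hK.union hL, fun x hx => ?_⟩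
    simp [h x fun hx' => hx (Or.inl hx'), h' x fun hx' => hx (Or.inr hx')]
  zero_mem' := ⟨∅, isCompact_empty, fun x _ => rfl⟩
  smul_mem' := by
    rintro c σ ⟨K, hK, h⟩
    exact ⟨K, hK, fun x hx => by simp [h x hx]⟩
  lie_mem' := by
    rintro σ τ ⟨K, hK, h⟩ -
    exact ⟨K, hK, fun x hx => by simp [h x hx]⟩

variable (B) in
/-- The compactly supported gauge algebra `Γ_c`. (A type of its own, since its topology is not the
one induced from `Γ`.) -/
def CompactSection : Type _ := B.compactlySupported

namespace CompactSection

instance : LieRing B.CompactSection := inferInstanceAs (LieRing B.compactlySupported)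

instance : LieAlgebra ℝ B.CompactSection := inferInstanceAs (LieAlgebra ℝ B.compactlySupported)

/-- The inclusion of `Γ_c` into `Γ`. -/
def toSmoothSection (σ : B.CompactSection) : B.SmoothSection := σ.1

instance : CoeFun B.CompactSection (fun _ => ∀ x, V x) := ⟨fun σ => σ.toSmoothSection⟩

variable [IsManifold 𝓘(ℝ, E) ∞ M]

variable (B) in
/-- The supremum over all compact sets `K` of the topologies coinduced by the inclusions
`Γ_K → Γ_c`, where the space `Γ_K` of sections vanishing outside `K` has the topology induced from
`Γ`. -/
@[reducible] def inductiveLimitTop : TopologicalSpace B.CompactSection :=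
  ⨆ K : TopologicalSpace.Compacts M,
    TopologicalSpace.coinduced
      (Subtype.val : {σ : B.CompactSection // ∀ x ∉ K, σ x = 0} → B.CompactSection)
      (TopologicalSpace.induced (fun σ => σ.1.toSmoothSection) inferInstance)

/-- The LF topology of `Γ_c`: the inductive limit of the `Γ_K` in the category of locally convex
spaces, that is, the finest locally convex vector space topology for which all the
inclusions `Γ_K → Γ_c` are continuous. -/
instance : TopologicalSpace B.CompactSection :=
  sInf {t | inductiveLimitTop B ≤ t ∧ @IsTopologicalAddGroup B.CompactSection t _ ∧
    @ContinuousSMul ℝ B.CompactSection _ _ t ∧ @LocallyConvexSpace ℝ B.CompactSection _ _ _ _ t}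

instance : IsTopologicalAddGroup B.CompactSection :=
  topologicalAddGroup_sInf fun _ ⟨_, ht, _, _⟩ => ht

instance : ContinuousSMul ℝ B.CompactSection :=
  continuousSMul_sInf fun _ ⟨_, _, ht, _⟩ => ht

instance : LocallyConvexSpace ℝ B.CompactSection :=
  .sInf fun _ ⟨_, _, _, ht⟩ => ht

end CompactSection

end LieAlgebraBundle

/-! ### The set of maximal ideals of the fibres -/

/-- The set of pairs `(x, I)` of a point `x : M` and a maximal ideal `I` of the fibre `V x`. -/
structure MaximalIdealSpace {M : Type u} (V : M → Type v)
    [∀ x, LieRing (V x)] [∀ x, LieAlgebra ℝ (V x)] where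
  /-- The point of the base. -/
  base : M
  /-- The maximal ideal of the fibre. -/
  ideal : LieIdeal ℝ (V base)
  isCoatom_ideal : IsCoatom ideal

end

/-! The ideals of a semisimple Lie algebra form a Boolean lattice. Maximal ideals are the
complements of the minimal ones; in finite dimension there are finitely many, and the algebra is the
product of its simple quotients by them. A trivialisation `e` identifies the maximal ideals of
nearby fibres with those of `e.model`, which cuts the cover over `e.baseSet` into sheets.

The crux is that sheets of different trivialisations fit together. Transition maps are continuous,
so two maximal ideals that differ at a point differ nearby (`eventually_comap_ne`). A maximal ideal
must correspond to one of finitely many candidates in the other model, so excluding the wrong ones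
makes agreement an open condition too (`eventually_comap_eq`). Hence sheets are open
(`isOpen_sheet`), the projection is a finite covering, and charts and trivialisations descend from
`M`.

Injectivity of `Φ` says that maximal ideals intersect in zero. For the inverse, linear sections `s
J` of the quotient maps of the model recover a section as the finite sum of its components on the
sheets (`exists_forall_toModel_eq_sum`); this formula gives both smoothness and the seminorm bound.
For compact supports, the projection is proper (`isCompact_preimage_proj`), and continuity follows
from the universal property of the LF topology (`continuous_compactSectionMap`). -/

noncomputable section

/-! ### Ideals and quotients of Lie algebras -/

namespace LieEquiv

variable {R L L' : Type*} [CommRing R] [LieRing L] [LieAlgebra R L] [LieRing L'] [LieAlgebra R L']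

/-- The order isomorphism between the lattices of ideals induced by an isomorphism of Lie
algebras. -/
def idealOrderIso (f : L ≃ₗ⁅R⁆ L') : LieIdeal R L ≃o LieIdeal R L' where
  toFun I := I.comap f.symm.toLieHom
  invFun I := I.comap f.toLieHom
  left_inv I := by ext x; simp [LieIdeal.mem_comap]
  right_inv I := by ext x; simp [LieIdeal.mem_comap]
  map_rel_iff' {I J} := by
    refine ⟨fun h x hx => ?_, fun h x hx => h hx⟩
    have := @h (f x)
    simp only [Equiv.coe_fn_mk, LieIdeal.mem_comap] at this
    simpa using this (by simpa using hx)

/-- Semisimplicity is known for the fibres but used in the models. Two of its axioms concern only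
the lattice of ideals; the non-abelian one is transported on elements. -/
theorem isSemisimple (f : L ≃ₗ⁅R⁆ L') [h : LieAlgebra.IsSemisimple R L] :
    LieAlgebra.IsSemisimple R L' := by
  have hS : {I : LieIdeal R L' | IsAtom I} = f.idealOrderIso '' {I | IsAtom I} := by
    ext I
    refine ⟨fun hI => ⟨f.idealOrderIso.symm I, ?_, by simp⟩, ?_⟩
    · exact (OrderIso.isAtom_iff _ _).2 hI
    · rintro ⟨J, hJ, rfl⟩
      exact (OrderIso.isAtom_iff _ _).2 hJ
  refine ⟨?_, ?_, ?_⟩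
  · rw [hS, sSup_image, ← OrderIso.map_sSup, h.sSup_atoms_eq_top, map_top]
  · rw [hS]
    rintro _ ⟨I, hI, rfl⟩
    have := (h.sSupIndep_isAtom hI).map_orderIso f.idealOrderIso
    rwa [OrderIso.map_sSup, ← sSup_image, Set.image_sdiff f.idealOrderIso.injective,
      Set.image_singleton] at this
  · intro I hI hab
    refine h.non_abelian_of_isAtom (f.idealOrderIso.symm I) ((OrderIso.isAtom_iff _ _).2 hI)
      ⟨fun x y => ?_⟩
    have := hab.trivial ⟨f x, x.2⟩ ⟨f y, y.2⟩
    have h2 := congrArg Subtype.val this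
    ext
    apply f.injective
    simpa using h2

end LieEquiv

namespace LieHom

variable {R L L' : Type*} [CommRing R] [LieRing L] [LieAlgebra R L] [LieRing L'] [LieAlgebra R L']

/-- The homomorphism between quotients induced by a homomorphism of Lie algebras. -/
def mapQuotient (f : L →ₗ⁅R⁆ L') (I : LieIdeal R L) (J : LieIdeal R L') (h : I ≤ J.comap f) :
    (L ⧸ I) →ₗ⁅R⁆ (L' ⧸ J) where
  __ := Submodule.mapQ I.toSubmodule J.toSubmodule (f : L →ₗ[R] L') h
  map_lie' {x y} := by
    obtain ⟨x, rfl⟩ := Submodule.Quotient.mk_surjective _ x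
    obtain ⟨y, rfl⟩ := Submodule.Quotient.mk_surjective _ y
    have := congrArg (LieSubmodule.Quotient.mk (N := J)) (f.map_lie x y)
    exact this

end LieHom

namespace LieAlgebra.IsSemisimple

section CommRing

variable {R L : Type*} [CommRing R] [LieRing L] [LieAlgebra R L] [LieAlgebra.IsSemisimple R L]

/-- Ideals of the quotient pull back to ideals above `I`, so only two occur. Were the quotient
abelian, brackets in the atom `Iᶜ` would lie in `I ⊓ Iᶜ = ⊥`. -/
theorem isSimple_quotient_of_isCoatom {I : LieIdeal R L} (hI : IsCoatom I) :
    LieAlgebra.IsSimple R (L ⧸ I) where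
  eq_bot_or_eq_top J := by
    let π : L →ₗ⁅R⁆ L ⧸ I :=
      { (LieSubmodule.Quotient.mk' I : L →ₗ[R] L ⧸ I) with
        map_lie' := fun {x y} => LieSubmodule.Quotient.mk_bracket I x y }
    have hle : I ≤ J.comap π := fun x hx => by
      rw [LieIdeal.mem_comap]
      have : π x = 0 := LieSubmodule.Quotient.mk_eq_zero'.2 hx
      rw [this]; exact J.zero_mem
    rcases hI.le_iff.1 hle with h | h
    · right
      refine eq_top_iff.2 fun x _ => ?_
      obtain ⟨x, rfl⟩ := LieSubmodule.Quotient.surjective_mk' I x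
      have : x ∈ J.comap π := h ▸ LieSubmodule.mem_top x
      exact this
    · left
      refine eq_bot_iff.2 fun x hx => ?_
      obtain ⟨x, rfl⟩ := LieSubmodule.Quotient.surjective_mk' I x
      have : x ∈ J.comap π := hx
      rw [h] at this
      exact (LieSubmodule.Quotient.mk_eq_zero _).2 this
  non_abelian hab := by
    have hA : IsAtom Iᶜ := isAtom_compl.2 hI
    refine non_abelian_of_isAtom _ hA ⟨fun x y => ?_⟩
    ext
    have h1 : ⁅(x : L), (y : L)⁆ ∈ I := by
      rw [← LieSubmodule.Quotient.mk_eq_zero', LieSubmodule.Quotient.mk_bracket]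
      exact hab.trivial _ _
    have h2 : ⁅(x : L), (y : L)⁆ ∈ Iᶜ := lie_mem_right R L _ _ _ y.2
    have h3 : ⁅(x : L), (y : L)⁆ ∈ I ⊓ Iᶜ := ⟨h1, h2⟩
    rw [inf_compl_self] at h3
    simpa using h3

/-- Complementation reduces this to atoms, which are independent, and an independent family in a
Noetherian lattice is finite. -/
theorem finite_isCoatom [IsNoetherian R L] : {I : LieIdeal R L | IsCoatom I}.Finite := by
  have h := WellFoundedGT.finite_of_sSupIndep (sSupIndep_isAtom (R := R) (L := L))
  refine (h.image compl).subset fun I hI => ⟨Iᶜ, isAtom_compl.2 hI, compl_compl I⟩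

theorem exists_isCoatom [Nontrivial L] [IsNoetherian R L] : ∃ I : LieIdeal R L, IsCoatom I := by
  have : Nontrivial (LieIdeal R L) := (LieSubmodule.nontrivial_iff R L L).2 ‹_›
  obtain ⟨I, hI, -⟩ := (eq_top_or_exists_le_coatom (⊥ : LieIdeal R L)).resolve_left bot_ne_top
  exact ⟨I, hI⟩

theorem eq_of_forall_mk_eq {a b : L}
    (h : ∀ I : LieIdeal R L, IsCoatom I →
      (LieSubmodule.Quotient.mk a : L ⧸ I) = LieSubmodule.Quotient.mk b) : a = b := by
  have hmem : ∀ I : LieIdeal R L, IsCoatom I → a - b ∈ I := fun I hI =>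
    (Submodule.Quotient.eq _).1 (h I hI)
  by_contra hne
  -- The complement of this intersection contains every atom, hence is everything.
  have hbot : (⊥ : LieIdeal R L) = sInf {I | IsCoatom I} := by
    rw [eq_comm, eq_bot_iff, ← compl_le_compl_iff_le, compl_bot, ← sSup_atoms_eq_top]
    refine sSup_le fun A hA => ?_
    rw [le_compl_iff_le_compl]
    exact sInf_le (isCoatom_compl.2 hA)
  have : a - b ∈ (⊥ : LieIdeal R L) := by
    rw [hbot, ← SetLike.mem_coe, LieSubmodule.coe_sInf, Set.mem_iInter₂]
    exact fun I hI => hmem I hI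
  exact hne (sub_eq_zero.1 (by simpa using this))

end CommRing

section Field

variable {K L : Type*} [Field K] [LieRing L] [LieAlgebra K L] [LieAlgebra.IsSemisimple K L]

/-- The quotient map by a maximal ideal of a semisimple Lie algebra has a linear section with
values in the intersection of the other maximal ideals. -/
theorem exists_section_quotient {I : LieIdeal K L} (hI : IsCoatom I) :
    ∃ s : (L ⧸ I) →ₗ[K] L, (∀ c, (LieSubmodule.Quotient.mk (s c) : L ⧸ I) = c) ∧
      ∀ J : LieIdeal K L, IsCoatom J → J ≠ I → ∀ c, s c ∈ J := by
  have hA : IsAtom Iᶜ := isAtom_compl.2 hI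
  -- The quotient map restricted to the complementary ideal is onto because `I ⊔ Iᶜ = ⊤`; the
  -- section is a linear right inverse of it.
  let f : (Iᶜ : LieIdeal K L) →ₗ[K] L ⧸ I :=
    (LieSubmodule.Quotient.mk' I : L →ₗ[K] L ⧸ I) ∘ₗ (Iᶜ : LieIdeal K L).toSubmodule.subtype
  have hf : LinearMap.range f = ⊤ := by
    refine eq_top_iff.2 fun c _ => ?_
    obtain ⟨x, rfl⟩ := LieSubmodule.Quotient.surjective_mk' I c
    have hx : x ∈ I ⊔ Iᶜ := by rw [sup_compl_eq_top]; trivial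
    obtain ⟨y, hy, z, hz, rfl⟩ := (LieSubmodule.mem_sup _ _ _).1 hx
    refine ⟨⟨z, hz⟩, ?_⟩
    have : LieSubmodule.Quotient.mk' I y = 0 := (LieSubmodule.Quotient.mk_eq_zero _).2 hy
    simp only [map_add, this, zero_add]
    rfl
  obtain ⟨g, hg⟩ := LinearMap.exists_rightInverse_of_surjective f hf
  refine ⟨(Iᶜ : LieIdeal K L).toSubmodule.subtype ∘ₗ g, fun c => LinearMap.congr_fun hg c,
    fun J hJ hne c => ?_⟩
  -- The distinct atoms `Iᶜ` and `Jᶜ` are disjoint.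
  have hle : Iᶜ ≤ J := by
    have := hA.disjoint_of_ne (isAtom_compl.2 hJ) fun h => hne (compl_injective h.symm)
    simpa using this.le_compl_right
  exact hle (g c).2

variable (L) in
/-- A semisimple Lie algebra is the direct sum of its quotients by maximal ideals: a family of
linear sections of the quotient maps, summing up to the inverse of the canonical map into the
product. -/
theorem exists_sections_quotient [FiniteDimensional K L] :
    ∃ s : ∀ I : {I : LieIdeal K L // IsCoatom I}, (L ⧸ I.1) →ₗ[K] L,
      ∀ [Fintype {I : LieIdeal K L // IsCoatom I}]
        (c : ∀ I : {I : LieIdeal K L // IsCoatom I}, L ⧸ I.1) (J : {I : LieIdeal K L // IsCoatom I}),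
        (LieSubmodule.Quotient.mk (∑ I, s I (c I)) : L ⧸ J.1) = c J := by
  choose s hs hs' using fun I : {I : LieIdeal K L // IsCoatom I} => exists_section_quotient I.2
  refine ⟨s, fun c J => ?_⟩
  have h1 : (LieSubmodule.Quotient.mk (∑ I, s I (c I)) : L ⧸ J.1) =
      ∑ I, (LieSubmodule.Quotient.mk (s I (c I)) : L ⧸ J.1) :=
    map_sum (LieSubmodule.Quotient.mk' J.1) _ _
  rw [h1, Finset.sum_eq_single J, hs]
  · intro I _ hIJ
    exact LieSubmodule.Quotient.mk_eq_zero'.2 (hs' I J.1 J.2 (fun h => hIJ (Subtype.ext h.symm)) _)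
  · simp

end Field

end LieAlgebra.IsSemisimple

/-! ### Maximal ideals in a local trivialisation -/

namespace LieTrivialization

variable {M : Type u} [TopologicalSpace M] {V : M → Type v}
  [∀ x, LieRing (V x)] [∀ x, LieAlgebra ℝ (V x)] (e : LieTrivialization V)

/-- The isomorphism of a fibre with the model. -/
def equivAt {x : M} (hx : x ∈ e.baseSet) : V x ≃ₗ⁅ℝ⁆ e.model where
  __ := e.toModel x
  invFun := e.ofModel x
  left_inv := e.ofModel_toModel x hx
  right_inv := e.toModel_ofModel x hx

theorem isCoatom_comap_toModel {x : M} (hx : x ∈ e.baseSet) {J : LieIdeal ℝ e.model}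
    (hJ : IsCoatom J) : IsCoatom (J.comap (e.toModel x)) :=
  ((e.equivAt hx).idealOrderIso.symm.isCoatom_iff J).2 hJ

/-- Over an empty base set the model is unconstrained, which is why later arguments treat that case
separately. -/
theorem isSemisimple_model [h : ∀ x, LieAlgebra.IsSemisimple ℝ (V x)]
    (hne : e.baseSet.Nonempty) : LieAlgebra.IsSemisimple ℝ e.model :=
  (e.equivAt hne.choose_spec).isSemisimple

end LieTrivialization

namespace LieAlgebraBundle

variable {E : Type w} [NormedAddCommGroup E] [NormedSpace ℝ E]
  {M : Type u} [TopologicalSpace M] [ChartedSpace E M] {V : M → Type v}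
  [∀ x, LieRing (V x)] [∀ x, LieAlgebra ℝ (V x)] (B : LieAlgebraBundle E V)

/-! ### The space of maximal ideals -/

/-- The set of maximal ideals of the fibres of a Lie algebra bundle. (A type of its own, since its
topology depends on the bundle.) -/
def IdealCover (_B : LieAlgebraBundle E V) : Type (max u v) := MaximalIdealSpace V

/-- The bundle projection of the space of maximal ideals. -/
def proj : B.IdealCover → M := MaximalIdealSpace.base

variable {B}

/-- A point of the space of maximal ideals, as an ideal. -/
def IdealCover.ideal (p : B.IdealCover) : LieIdeal ℝ (V (B.proj p)) := MaximalIdealSpace.ideal p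

theorem IdealCover.isCoatom_ideal (p : B.IdealCover) : IsCoatom p.ideal :=
  MaximalIdealSpace.isCoatom_ideal p

/-- The ideal of the model corresponding to a maximal ideal of a fibre. -/
def label (e : LieTrivialization V) (p : B.IdealCover) : LieIdeal ℝ e.model :=
  p.ideal.comap (e.ofModel (B.proj p))

theorem isCoatom_label (e : LieTrivialization V) {p : B.IdealCover} (hp : B.proj p ∈ e.baseSet) :
    IsCoatom (label e p) :=
  ((e.equivAt hp).idealOrderIso.isCoatom_iff p.ideal).2 p.isCoatom_ideal

variable (B) in
/-- The maximal ideals of the fibres that correspond to a given ideal of the model. -/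
def sheet (e : LieTrivialization V) (J : LieIdeal ℝ e.model) : Set B.IdealCover :=
  {p | B.proj p ∈ e.baseSet ∧ label e p = J}

variable {e : LieTrivialization V} {J : LieIdeal ℝ e.model}

theorem mem_ideal_iff_of_mem_sheet {p : B.IdealCover}
    (hp : p ∈ B.sheet e J) {a : V (B.proj p)} : a ∈ p.ideal ↔ e.toModel (B.proj p) a ∈ J := by
  rw [← hp.2, label, LieIdeal.mem_comap, e.ofModel_toModel _ hp.1]

theorem isCoatom_of_mem_sheet {p : B.IdealCover} (hp : p ∈ B.sheet e J) : IsCoatom J :=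
  hp.2 ▸ isCoatom_label e hp.1

theorem ofModel_mem_ideal_iff {p : B.IdealCover}
    (hp : p ∈ B.sheet e J) {b : e.model} : e.ofModel (B.proj p) b ∈ p.ideal ↔ b ∈ J := by
  rw [mem_ideal_iff_of_mem_sheet hp, e.toModel_ofModel _ hp.1]

variable (B) in
theorem injOn_proj_sheet (e : LieTrivialization V) (J : LieIdeal ℝ e.model) :
    Set.InjOn B.proj (B.sheet e J) := by
  intro p hp q hq h
  obtain ⟨x, I, hI⟩ := p
  obtain ⟨x', I', hI'⟩ := q
  obtain rfl : x = x' := h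
  obtain rfl : I = I' := by
    ext a
    exact (mem_ideal_iff_of_mem_sheet hp).trans (mem_ideal_iff_of_mem_sheet hq).symm
  rfl

variable (B e) in
/-- The maximal ideal of a fibre that corresponds to a maximal ideal of the model. -/
def lift (hJ : IsCoatom J) {x : M} (hx : x ∈ e.baseSet) : B.IdealCover :=
  MaximalIdealSpace.mk x (J.comap (e.toModel x)) (e.isCoatom_comap_toModel hx hJ)

theorem lift_mem_sheet (hJ : IsCoatom J) {x : M} (hx : x ∈ e.baseSet) :
    B.lift e hJ hx ∈ B.sheet e J := by
  refine ⟨hx, ?_⟩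
  ext b
  change e.toModel x (e.ofModel x b) ∈ J ↔ b ∈ J
  rw [e.toModel_ofModel _ hx]

variable (B) in
theorem image_proj_sheet (hJ : IsCoatom J) : B.proj '' B.sheet e J = e.baseSet := by
  refine Set.Subset.antisymm ?_ fun x hx => ⟨_, lift_mem_sheet hJ hx, rfl⟩
  rintro _ ⟨p, hp, rfl⟩
  exact hp.1

/-! ### Comparing maximal ideals across two trivialisations -/

variable (B)

variable {B} in
-- A vector in the first ideal but not the second is detected by a functional `l` vanishing on `J'`.
-- Extend the vector to nearby fibres, constant in `e`: it stays in the first ideal, and `l` of it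
-- remains nonzero by continuity of the transition.
theorem eventually_comap_ne {e e' : LieTrivialization V} (he : e ∈ B.trivializations)
    (he' : e' ∈ B.trivializations) {J : LieIdeal ℝ e.model} (hJ : IsCoatom J)
    {J' : LieIdeal ℝ e'.model} (hJ' : IsCoatom J') {x₀ : M} (hx : x₀ ∈ e.baseSet)
    (hx' : x₀ ∈ e'.baseSet) (hne : J.comap (e.toModel x₀) ≠ J'.comap (e'.toModel x₀)) :
    ∀ᶠ x in 𝓝 x₀, J.comap (e.toModel x) ≠ J'.comap (e'.toModel x) := by
  -- Distinct maximal ideals are incomparable.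
  have hnle : ¬ J.comap (e.toModel x₀) ≤ J'.comap (e'.toModel x₀) := fun hle =>
    hne (((e.isCoatom_comap_toModel hx hJ).le_iff.1 hle).resolve_left
      (e'.isCoatom_comap_toModel hx' hJ').1).symm
  obtain ⟨a, ha, ha'⟩ := SetLike.not_le_iff_exists.1 hnle
  rw [LieIdeal.mem_comap] at ha ha'
  obtain ⟨l, hl, hla⟩ : ∃ l ∈ J'.toSubmodule.dualAnnihilator, l (e'.toModel x₀ a) ≠ 0 := by
    by_contra! h
    exact ha' ((Subspace.forall_mem_dualAnnihilator_apply_eq_zero_iff J'.toSubmodule _).1 h)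
  have hU : e.baseSet ∩ e'.baseSet ∈ 𝓝 x₀ :=
    (e.isOpen_baseSet.inter e'.isOpen_baseSet).mem_nhds ⟨hx, hx'⟩
  have hcont := ((B.contMDiffOn_transition e he e' he' (e.toModel x₀ a) l).continuousOn).continuousAt
    hU
  have hev := hcont.eventually_ne (by rwa [e.ofModel_toModel _ hx])
  filter_upwards [hev, hU] with x hxl hxU heq
  refine hxl ((Submodule.mem_dualAnnihilator l).1 hl _ ?_)
  have : e.ofModel x (e.toModel x₀ a) ∈ J'.comap (e'.toModel x) := by
    rw [← heq, LieIdeal.mem_comap, e.toModel_ofModel _ hxU.1]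
    exact ha
  exact this

variable {B} in
-- Near `x₀` the ideal differs from those given by the finitely many maximal ideals of `e'.model`
-- other than `J'`. Since it comes from some maximal ideal of `e'.model`, its label, only `J'` is
-- left.
theorem eventually_comap_eq [∀ x, LieAlgebra.IsSemisimple ℝ (V x)] {e e' : LieTrivialization V}
    (he : e ∈ B.trivializations) (he' : e' ∈ B.trivializations) {J : LieIdeal ℝ e.model}
    (hJ : IsCoatom J) {J' : LieIdeal ℝ e'.model} {x₀ : M} (hx : x₀ ∈ e.baseSet)
    (hx' : x₀ ∈ e'.baseSet) (heq : J.comap (e.toModel x₀) = J'.comap (e'.toModel x₀)) :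
    ∀ᶠ x in 𝓝 x₀, J.comap (e.toModel x) = J'.comap (e'.toModel x) := by
  have := e'.isSemisimple_model ⟨x₀, hx'⟩
  have hfin := (LieAlgebra.IsSemisimple.finite_isCoatom (R := ℝ) (L := e'.model)).subset
    (Set.sep_subset {I : LieIdeal ℝ e'.model | IsCoatom I} fun I => I ≠ J')
  have hev : ∀ᶠ x in 𝓝 x₀, ∀ J₁ ∈ {I ∈ {I : LieIdeal ℝ e'.model | IsCoatom I} | I ≠ J'},
      J.comap (e.toModel x) ≠ J₁.comap (e'.toModel x) := by
    rw [Filter.eventually_all_finite hfin]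
    intro J₁ hJ₁
    refine eventually_comap_ne he he' hJ hJ₁.1 hx hx' fun h => hJ₁.2 ?_
    exact (e'.equivAt hx').idealOrderIso.symm.injective (h.symm.trans heq)
  filter_upwards [hev, e.isOpen_baseSet.mem_nhds hx, e'.isOpen_baseSet.mem_nhds hx']
    with x hx1 hxe hxe'
  have hp : B.proj (B.lift e hJ hxe) ∈ e'.baseSet := hxe'
  have hcoe : J.comap (e.toModel x) = (label e' (B.lift e hJ hxe)).comap (e'.toModel x) := by
    ext a
    exact mem_ideal_iff_of_mem_sheet (J := label e' (B.lift e hJ hxe)) ⟨hp, rfl⟩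
  by_contra hne
  exact hx1 _ ⟨isCoatom_label e' hp, fun h => hne (h ▸ hcoe)⟩ hcoe

/-! ### The topology of the space of maximal ideals -/

/-- A set of maximal ideals is open if its intersections with all sheets have open projections. -/
instance : TopologicalSpace B.IdealCover where
  IsOpen U := ∀ e ∈ B.trivializations, ∀ J : LieIdeal ℝ e.model, IsOpen (B.proj '' (U ∩ B.sheet e J))
  isOpen_univ e he J := by
    rw [Set.univ_inter]
    rcases (B.sheet e J).eq_empty_or_nonempty with h | ⟨p, hp⟩
    · rw [h, Set.image_empty]; exact isOpen_empty
    · exact (B.image_proj_sheet (isCoatom_of_mem_sheet hp)).symm ▸ e.isOpen_baseSet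
  isOpen_inter U U' h h' e he J := by
    rw [Set.inter_inter_distrib_right, (B.injOn_proj_sheet e J).image_inter]
    · exact (h e he J).inter (h' e he J)
    · exact Set.inter_subset_right
    · exact Set.inter_subset_right
  isOpen_sUnion S h e he J := by
    rw [Set.sUnion_eq_biUnion, Set.iUnion₂_inter, Set.image_iUnion₂]
    exact isOpen_biUnion fun U hU => h U hU e he J

theorem continuous_proj : Continuous B.proj := by
  refine ⟨fun W hW e he J => ?_⟩
  rw [Set.image_preimage_inter, ← Set.univ_inter (B.sheet e J)]
  exact hW.inter (isOpen_univ (X := B.IdealCover) e he J)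

variable {B}

/-- The topology tests a sheet against all sheets of all trivialisations, so this amounts to
`eventually_comap_eq`. -/
theorem isOpen_sheet [∀ x, LieAlgebra.IsSemisimple ℝ (V x)] {e : LieTrivialization V}
    (he : e ∈ B.trivializations) (J : LieIdeal ℝ e.model) :
    IsOpen (X := B.IdealCover) (B.sheet e J) := by
  intro e' he' J'
  rw [isOpen_iff_mem_nhds]
  rintro _ ⟨p, ⟨hp, hp'⟩, rfl⟩
  have hJ := isCoatom_of_mem_sheet hp
  have h := eventually_comap_eq he he' hJ (J' := J') hp.1 hp'.1 (by
    ext a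
    exact (mem_ideal_iff_of_mem_sheet hp).symm.trans
      (mem_ideal_iff_of_mem_sheet hp'))
  filter_upwards [h, e.isOpen_baseSet.mem_nhds hp.1, e'.isOpen_baseSet.mem_nhds hp'.1]
    with x hx hxe hxe'
  refine ⟨B.lift e hJ hxe, ⟨lift_mem_sheet hJ hxe, hxe', ?_⟩, rfl⟩
  ext b
  change e'.ofModel x b ∈ J.comap (e.toModel x) ↔ b ∈ J'
  rw [hx, LieIdeal.mem_comap, e'.toModel_ofModel _ hxe']

theorem isOpen_image_proj_of_subset_sheet {e : LieTrivialization V}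
    (he : e ∈ B.trivializations) {J : LieIdeal ℝ e.model} {U : Set B.IdealCover} (hU : IsOpen U)
    (h : U ⊆ B.sheet e J) : IsOpen (B.proj '' U) := by
  simpa [Set.inter_eq_left.2 h] using hU e he J

/-- The local section of the space of maximal ideals given by a maximal ideal of the model of a
trivialisation, as a partial homeomorphism. (The point `p` is the arbitrary value of the inverse
outside of its domain.) -/
def sheetHomeomorph [∀ x, LieAlgebra.IsSemisimple ℝ (V x)] {e : LieTrivialization V}
    (he : e ∈ B.trivializations) {J : LieIdeal ℝ e.model} (hJ : IsCoatom J) (p : B.IdealCover) :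
    OpenPartialHomeomorph B.IdealCover M where
  toFun := B.proj
  invFun x := open Classical in if hx : x ∈ e.baseSet then B.lift e hJ hx else p
  source := B.sheet e J
  target := e.baseSet
  map_source' p hp := hp.1
  map_target' x hx := by rw [dif_pos hx]; exact lift_mem_sheet hJ hx
  left_inv' p hp := by
    have h : B.proj p ∈ e.baseSet := hp.1
    rw [dif_pos h]
    exact B.injOn_proj_sheet e J (lift_mem_sheet hJ h) hp rfl
  right_inv' x hx := by rw [dif_pos hx]; rfl
  continuousOn_toFun := B.continuous_proj.continuousOn
  continuousOn_invFun := by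
    -- The preimage of `U` under the local section is the projection of `U ∩ B.sheet e J`, open by
    -- definition of the topology.
    rw [continuousOn_open_iff e.isOpen_baseSet]
    intro U hU
    convert! hU e he J using 1
    ext x
    constructor
    · rintro ⟨hx, hxU⟩
      rw [Set.mem_preimage, dif_pos hx] at hxU
      exact ⟨_, ⟨hxU, lift_mem_sheet hJ hx⟩, rfl⟩
    · rintro ⟨q, ⟨hqU, hq⟩, rfl⟩
      have h : B.proj q ∈ e.baseSet := hq.1
      refine ⟨h, ?_⟩
      rw [Set.mem_preimage, dif_pos h]
      convert! hqU
      exact B.injOn_proj_sheet e J (lift_mem_sheet hJ h) hq rfl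
  open_source := isOpen_sheet he J
  open_target := e.isOpen_baseSet

section

variable [∀ x, LieAlgebra.IsSemisimple ℝ (V x)] {e : LieTrivialization V}
    (he : e ∈ B.trivializations) {J : LieIdeal ℝ e.model} (hJ : IsCoatom J) (p : B.IdealCover)

theorem proj_sheetHomeomorph_symm {x : M} (hx : x ∈ e.baseSet) :
    B.proj ((sheetHomeomorph he hJ p).symm x) = x :=
  (sheetHomeomorph he hJ p).right_inv hx

theorem sheetHomeomorph_symm_mem {x : M} (hx : x ∈ e.baseSet) :
    (sheetHomeomorph he hJ p).symm x ∈ B.sheet e J :=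
  (sheetHomeomorph he hJ p).map_target hx

end

/-! ### Finiteness, separation, covering property and countability -/

variable (B)

/-- A trivialisation of the bundle at a point. -/
def trivAt (x : M) : LieTrivialization V := (B.exists_mem_baseSet x).choose

theorem trivAt_mem (x : M) : B.trivAt x ∈ B.trivializations :=
  (B.exists_mem_baseSet x).choose_spec.1

theorem mem_baseSet_trivAt (x : M) : x ∈ (B.trivAt x).baseSet :=
  (B.exists_mem_baseSet x).choose_spec.2

theorem finite_preimage_proj [∀ x, LieAlgebra.IsSemisimple ℝ (V x)] (x : M) :
    (B.proj ⁻¹' {x}).Finite := by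
  have := (B.trivAt x).isSemisimple_model ⟨x, B.mem_baseSet_trivAt x⟩
  refine Set.Finite.of_finite_image (f := label (B.trivAt x))
    ((LieAlgebra.IsSemisimple.finite_isCoatom (R := ℝ) (L := (B.trivAt x).model)).subset ?_) ?_
  · rintro _ ⟨p, rfl, rfl⟩
    exact isCoatom_label (B.trivAt _) (B.mem_baseSet_trivAt _)
  · rintro p rfl q hq h
    refine B.injOn_proj_sheet (B.trivAt (B.proj p)) (label (B.trivAt (B.proj p)) p)
      ⟨B.mem_baseSet_trivAt _, rfl⟩ ⟨?_, h.symm⟩ hq.symm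
    rw [hq]
    exact B.mem_baseSet_trivAt _

theorem nonempty_preimage_proj [∀ x, LieAlgebra.IsSemisimple ℝ (V x)] (x : M) [Nontrivial (V x)] :
    (B.proj ⁻¹' {x}).Nonempty := by
  have := (B.trivAt x).isSemisimple_model ⟨x, B.mem_baseSet_trivAt x⟩
  have : Nontrivial (B.trivAt x).model :=
    ((B.trivAt x).equivAt (B.mem_baseSet_trivAt x)).symm.surjective.nontrivial
  obtain ⟨J, hJ⟩ := LieAlgebra.IsSemisimple.exists_isCoatom (R := ℝ) (L := (B.trivAt x).model)
  exact ⟨B.lift (B.trivAt x) hJ (B.mem_baseSet_trivAt x), rfl⟩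

/-- Distinct points of one fibre have distinct labels, so disjoint sheets of one trivialisation
separate them; points of different fibres are separated in `M`. -/
instance [∀ x, LieAlgebra.IsSemisimple ℝ (V x)] [T2Space M] : T2Space B.IdealCover := by
  refine ⟨fun p q hpq => ?_⟩
  by_cases h : B.proj p = B.proj q
  · let e := B.trivAt (B.proj p)
    have he := B.trivAt_mem (B.proj p)
    have hp : B.proj p ∈ e.baseSet := B.mem_baseSet_trivAt _
    have hq : B.proj q ∈ e.baseSet := h ▸ hp
    refine ⟨B.sheet e (label e p), B.sheet e (label e q), isOpen_sheet he _, isOpen_sheet he _,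
      ⟨hp, rfl⟩, ⟨hq, rfl⟩, Set.disjoint_left.2 fun r hr hr' => hpq ?_⟩
    exact B.injOn_proj_sheet e (label e p) ⟨hp, rfl⟩ ⟨hq, hr'.2.symm.trans hr.2⟩ h
  · obtain ⟨U, U', hU, hU', hp, hq, hd⟩ := t2_separation h
    exact ⟨_, _, hU.preimage B.continuous_proj, hU'.preimage B.continuous_proj, hp, hq,
      hd.preimage _⟩

theorem isCoveringMap_proj [∀ x, LieAlgebra.IsSemisimple ℝ (V x)] : IsCoveringMap B.proj := by
  intro x
  let e := B.trivAt x
  have he : e ∈ B.trivializations := B.trivAt_mem x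
  have hx : x ∈ e.baseSet := B.mem_baseSet_trivAt x
  -- Without maximal ideals in the model, nothing lies over `e.baseSet`; otherwise the sheets
  -- trivialise the projection there.
  rcases isEmpty_or_nonempty {J : LieIdeal ℝ e.model // IsCoatom J} with hι | hι
  · have : IsEmpty (B.proj ⁻¹' {x}) := by
      refine ⟨?_⟩
      rintro ⟨p, rfl⟩
      exact hι.false ⟨label e p, isCoatom_label e hx⟩
    refine .of_preimage_eq_empty _ (e.isOpen_baseSet.mem_nhds hx) ?_
    refine Set.eq_empty_of_forall_notMem fun p hp => ?_
    exact hι.false ⟨label e p, isCoatom_label e hp⟩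
  · have hE : Nonempty B.IdealCover := ⟨B.lift e hι.some.2 hx⟩
    let : TopologicalSpace {J : LieIdeal ℝ e.model // IsCoatom J} := ⊥
    have : DiscreteTopology {J : LieIdeal ℝ e.model // IsCoatom J} := ⟨rfl⟩
    refine (IsEvenlyCovered.of_trivialization (t := e.isOpen_baseSet.trivializationDiscrete
      (f := B.proj) (fun J : {J : LieIdeal ℝ e.model // IsCoatom J} => B.sheet e J.1) _
      (fun J W hW => ⟨fun h => (h.preimage B.continuous_proj).inter (isOpen_sheet he _),
        fun h => ?_⟩) (fun J => B.injOn_proj_sheet e J.1)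
      (fun J => (B.image_proj_sheet J.2).ge) ?_
      fun p hp => Set.mem_iUnion.2 ⟨⟨label e p, isCoatom_label e hp⟩, hp, rfl⟩)
      hx).to_isEvenlyCovered_preimage
    · have := isOpen_image_proj_of_subset_sheet he h Set.inter_subset_right
      rw [Set.image_preimage_inter] at this
      convert! this using 1
      exact (Set.inter_eq_left.2 (hW.trans (B.image_proj_sheet J.2).ge)).symm
    · intro J J' hne
      exact Set.disjoint_left.2 fun p hp hp' => hne (Subtype.ext (hp.2.symm.trans hp'.2))

/-- Countably many base sets cover `M`, each carries finitely many sheets, and each nonempty sheet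
is homeomorphic to an open subset of `M`. -/
instance [∀ x, LieAlgebra.IsSemisimple ℝ (V x)] [SecondCountableTopology M] :
    SecondCountableTopology B.IdealCover := by
  obtain ⟨s, hs, hU⟩ := TopologicalSpace.countable_cover_nhds
    (f := fun x => (B.trivAt x).baseSet)
    fun x => (B.trivAt x).isOpen_baseSet.mem_nhds (B.mem_baseSet_trivAt x)
  have : Countable s := hs
  have hfin : ∀ x : s, Finite {J : LieIdeal ℝ (B.trivAt x).model // IsCoatom J} := fun x => by
    have := (B.trivAt x).isSemisimple_model ⟨x, B.mem_baseSet_trivAt x⟩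
    exact LieAlgebra.IsSemisimple.finite_isCoatom (R := ℝ) (L := (B.trivAt x).model)
  let U : (Σ x : s, {J : LieIdeal ℝ (B.trivAt x).model // IsCoatom J}) → Set B.IdealCover :=
    fun i => B.sheet (B.trivAt i.1) i.2.1
  have hsc : ∀ i, SecondCountableTopology (U i) := fun i => by
    rcases (U i).eq_empty_or_nonempty with h | ⟨p, hp⟩
    · rw [h]; infer_instance
    · exact (sheetHomeomorph (B.trivAt_mem i.1) i.2.2 p).toHomeomorphSourceTarget.secondCountableTopology
  refine TopologicalSpace.secondCountableTopology_of_countable_cover (U := U)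
    (fun i => isOpen_sheet (B.trivAt_mem _) _) ?_
  refine Set.eq_univ_of_forall fun p => ?_
  obtain ⟨x, hx, hxp⟩ := Set.mem_iUnion₂.1 (hU ▸ Set.mem_univ (B.proj p))
  exact Set.mem_iUnion.2 ⟨⟨⟨x, hx⟩, label (B.trivAt x) p, isCoatom_label (B.trivAt x) hxp⟩, hxp, rfl⟩

end LieAlgebraBundle

namespace LieAlgebraBundle

variable {E : Type w} [NormedAddCommGroup E] [NormedSpace ℝ E]
  {M : Type u} [TopologicalSpace M] [ChartedSpace E M] {V : M → Type v}
  [∀ x, LieRing (V x)] [∀ x, LieAlgebra ℝ (V x)] (B : LieAlgebraBundle E V)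

/-! ### The smooth structure of the space of maximal ideals -/

section SmoothStructure

variable [∀ x, LieAlgebra.IsSemisimple ℝ (V x)]

/-- The atlas admits every sheet and every chart of `M`, not only those chosen by `chartAt`, so that
any sheet can serve in smoothness proofs and as seminorm data. -/
instance : ChartedSpace E B.IdealCover where
  atlas := {c | ∃ (e : LieTrivialization V) (he : e ∈ B.trivializations) (J : LieIdeal ℝ e.model)
    (hJ : IsCoatom J) (p : B.IdealCover) (φ : OpenPartialHomeomorph M E),
      φ ∈ atlas E M ∧ c = (sheetHomeomorph he hJ p).trans φ}
  chartAt p := (sheetHomeomorph (B.trivAt_mem (B.proj p))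
    (isCoatom_label _ (B.mem_baseSet_trivAt (B.proj p))) p).trans (chartAt E (B.proj p))
  mem_chart_source p := by
    rw [OpenPartialHomeomorph.trans_source]
    exact ⟨⟨B.mem_baseSet_trivAt (B.proj p), rfl⟩, mem_chart_source E (B.proj p)⟩
  chart_mem_atlas p := ⟨_, _, _, _, _, _, chart_mem_atlas E _, rfl⟩

variable {B}

theorem mem_atlas_idealCover_iff {c : OpenPartialHomeomorph B.IdealCover E} :
    c ∈ atlas E B.IdealCover ↔ ∃ (e : LieTrivialization V) (he : e ∈ B.trivializations)
      (J : LieIdeal ℝ e.model) (hJ : IsCoatom J) (p : B.IdealCover)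
      (φ : OpenPartialHomeomorph M E), φ ∈ atlas E M ∧ c = (sheetHomeomorph he hJ p).trans φ :=
  Iff.rfl

theorem sheetHomeomorph_trans_mem_atlas {e : LieTrivialization V} (he : e ∈ B.trivializations)
    {J : LieIdeal ℝ e.model} (hJ : IsCoatom J) (p : B.IdealCover)
    {φ : OpenPartialHomeomorph M E} (hφ : φ ∈ atlas E M) :
    (sheetHomeomorph he hJ p).trans φ ∈ atlas E B.IdealCover :=
  ⟨e, he, J, hJ, p, φ, hφ, rfl⟩

theorem proj_sheetHomeomorph_trans_symm {e : LieTrivialization V} {he : e ∈ B.trivializations}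
    {J : LieIdeal ℝ e.model} {hJ : IsCoatom J} {p : B.IdealCover}
    {φ : OpenPartialHomeomorph M E} {y : E}
    (hy : y ∈ ((sheetHomeomorph he hJ p).trans φ).target) :
    B.proj (((sheetHomeomorph he hJ p).trans φ).symm y) = φ.symm y := by
  rw [OpenPartialHomeomorph.trans_target] at hy
  exact proj_sheetHomeomorph_symm he hJ p hy.2

variable (B) in
instance [IsManifold 𝓘(ℝ, E) ∞ M] : IsManifold 𝓘(ℝ, E) ∞ B.IdealCover where
  compatible := by
    rintro c c' ⟨e, he, J, hJ, p, φ, hφ, rfl⟩ ⟨e', he', J', hJ', p', φ', hφ', rfl⟩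
    set c := (sheetHomeomorph he hJ p).trans φ
    set c' := (sheetHomeomorph he' hJ' p').trans φ'
    have heq : ∀ y ∈ (c.symm.trans c').source, B.proj (c.symm y) = φ.symm y := fun y hy => by
      rw [OpenPartialHomeomorph.trans_source] at hy
      exact proj_sheetHomeomorph_trans_symm hy.1
    have hsub : (c.symm.trans c').source ⊆ (φ.symm.trans φ').source := by
      intro y hy
      have hy' := hy
      rw [OpenPartialHomeomorph.trans_source] at hy'
      rw [OpenPartialHomeomorph.trans_source]
      refine ⟨?_, ?_⟩
      · have h1 := hy'.1
        rw [OpenPartialHomeomorph.symm_source, OpenPartialHomeomorph.trans_target] at h1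
        exact h1.1
      · have h2 := hy'.2
        rw [Set.mem_preimage, OpenPartialHomeomorph.trans_source] at h2
        have h3 : B.proj (c.symm y) ∈ φ'.source := h2.2
        rwa [heq y hy] at h3
    -- Both charts factor through the projection, so their transition is a restriction of a
    -- transition of `M`.
    refine (contDiffGroupoid ∞ 𝓘(ℝ, E)).mem_of_eqOnSource (closedUnderRestriction'
      (HasGroupoid.compatible (G := contDiffGroupoid ∞ 𝓘(ℝ, E)) hφ hφ')
      (c.symm.trans c').open_source) ⟨?_, fun y hy => ?_⟩
    · rw [OpenPartialHomeomorph.restr_source' _ _ (c.symm.trans c').open_source,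
        Set.inter_eq_right.2 hsub]
    · exact congrArg φ' (heq y hy)

variable [IsManifold 𝓘(ℝ, E) ∞ M]

variable (B) in
theorem contMDiff_proj : ContMDiff 𝓘(ℝ, E) 𝓘(ℝ, E) ∞ B.proj := by
  intro p
  obtain ⟨e, he, J, hJ, q, φ, hφ, hc⟩ :=
    mem_atlas_idealCover_iff.1 (chart_mem_atlas E p)
  have hs : (chartAt E p).source ∈ 𝓝 p := (chartAt E p).open_source.mem_nhds (mem_chart_source E p)
  have h1 := (contMDiffOn_symm_of_mem_maximalAtlas (I := 𝓘(ℝ, E)) (n := ∞)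
    (IsManifold.subset_maximalAtlas hφ)).comp (t := φ.target) (contMDiffOn_of_mem_maximalAtlas
      (IsManifold.chart_mem_maximalAtlas (I := 𝓘(ℝ, E)) (n := ∞) p)) (by
        intro r hr
        have := (chartAt E p).map_source hr
        rw [hc, OpenPartialHomeomorph.trans_target] at this
        rw [Set.mem_preimage, hc]
        exact this.1)
  refine (h1.congr fun r hr => ?_).contMDiffAt hs
  rw [hc, OpenPartialHomeomorph.trans_source] at hr
  rw [Function.comp_apply, hc]
  exact (φ.left_inv hr.2).symm

theorem contMDiffOn_sheetHomeomorph_symm {e : LieTrivialization V} (he : e ∈ B.trivializations)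
    {J : LieIdeal ℝ e.model} (hJ : IsCoatom J) (p : B.IdealCover) :
    ContMDiffOn 𝓘(ℝ, E) 𝓘(ℝ, E) ∞ (sheetHomeomorph he hJ p).symm e.baseSet := by
  intro x hx
  set s := sheetHomeomorph he hJ p
  have hmem := sheetHomeomorph_trans_mem_atlas he hJ p (chart_mem_atlas E x)
  have hU : e.baseSet ∩ (chartAt E x).source ∈ 𝓝 x :=
    (e.isOpen_baseSet.inter (chartAt E x).open_source).mem_nhds ⟨hx, mem_chart_source E x⟩
  have h1 := (contMDiffOn_symm_of_mem_maximalAtlas (I := 𝓘(ℝ, E)) (n := ∞)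
    (IsManifold.subset_maximalAtlas hmem)).comp (t := (s.trans (chartAt E x)).target)
      ((contMDiffOn_of_mem_maximalAtlas (IsManifold.chart_mem_maximalAtlas (I := 𝓘(ℝ, E))
        (n := ∞) x)).mono (Set.inter_subset_right (s := e.baseSet))) (by
        rintro z ⟨hz, hz'⟩
        rw [Set.mem_preimage, OpenPartialHomeomorph.trans_target]
        refine ⟨(chartAt E x).map_source hz', ?_⟩
        rw [Set.mem_preimage, (chartAt E x).left_inv hz']
        exact hz)
  refine ((h1.congr fun z hz => ?_).contMDiffAt hU).contMDiffWithinAt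
  exact congrArg s.symm ((chartAt E x).left_inv hz.2).symm

variable (B) in
theorem isLocalDiffeomorph_proj : IsLocalDiffeomorph 𝓘(ℝ, E) 𝓘(ℝ, E) ∞ B.proj := by
  intro p
  have hp := B.mem_baseSet_trivAt (B.proj p)
  let s := sheetHomeomorph (B.trivAt_mem (B.proj p)) (isCoatom_label _ hp) p
  exact ⟨⟨s.toPartialEquiv, s.open_source, s.open_target, B.contMDiff_proj.contMDiffOn,
    contMDiffOn_sheetHomeomorph_symm (B.trivAt_mem _) _ _⟩, ⟨hp, rfl⟩, fun _ _ => rfl⟩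

end SmoothStructure

/-! ### The bundle of simple quotients -/

theorem le_comap_toModel_of_mem_sheet {B : LieAlgebraBundle E V} {e : LieTrivialization V}
    {J : LieIdeal ℝ e.model} {p : B.IdealCover}
    (hp : p ∈ B.sheet e J) : p.ideal ≤ J.comap (e.toModel (B.proj p)) :=
  fun _ ha => (mem_ideal_iff_of_mem_sheet hp).1 ha

theorem le_comap_ofModel_of_mem_sheet {B : LieAlgebraBundle E V} {e : LieTrivialization V}
    {J : LieIdeal ℝ e.model} {p : B.IdealCover}
    (hp : p ∈ B.sheet e J) : J ≤ p.ideal.comap (e.ofModel (B.proj p)) :=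
  fun _ hb => (ofModel_mem_ideal_iff hp).2 hb

/-- The fibre `V x ⧸ I` over `(x, I)`. -/
abbrev QuotientFibre (p : B.IdealCover) : Type v := V (B.proj p) ⧸ p.ideal

variable [∀ x, LieAlgebra.IsSemisimple ℝ (V x)]

variable {B}

open Classical in
/-- The trivialisation of the quotients by maximal ideals over a sheet. -/
def quotientTrivialization {e : LieTrivialization V} (he : e ∈ B.trivializations)
    (J : LieIdeal ℝ e.model) : LieTrivialization B.QuotientFibre where
  baseSet := B.sheet e J
  isOpen_baseSet := isOpen_sheet he J
  model := e.model ⧸ J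
  finiteDimensional := inferInstanceAs (FiniteDimensional ℝ (e.model ⧸ J.toSubmodule))
  -- Only on the sheet does `e` match `p.ideal` with `J` and descend to quotients; zero is a junk
  -- value.
  toModel p := if hp : p ∈ B.sheet e J then
    (e.toModel (B.proj p)).mapQuotient p.ideal J (le_comap_toModel_of_mem_sheet hp) else 0
  ofModel p := if hp : p ∈ B.sheet e J then
    (e.ofModel (B.proj p)).mapQuotient J p.ideal (le_comap_ofModel_of_mem_sheet hp) else 0
  ofModel_toModel p hp a := by
    obtain ⟨a, rfl⟩ := LieSubmodule.Quotient.surjective_mk' _ a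
    rw [dif_pos hp, dif_pos hp]
    exact congrArg LieSubmodule.Quotient.mk (e.ofModel_toModel _ hp.1 a)
  toModel_ofModel p hp b := by
    obtain ⟨b, rfl⟩ := LieSubmodule.Quotient.surjective_mk' _ b
    rw [dif_pos hp, dif_pos hp]
    exact congrArg LieSubmodule.Quotient.mk (e.toModel_ofModel _ hp.1 b)

section

variable {e : LieTrivialization V} (he : e ∈ B.trivializations) {J : LieIdeal ℝ e.model}
  {p : B.IdealCover}

theorem quotientTrivialization_toModel_mk (hp : p ∈ B.sheet e J) (a : V (B.proj p)) :
    (quotientTrivialization he J).toModel p (LieSubmodule.Quotient.mk a) =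
      (LieSubmodule.Quotient.mk (e.toModel (B.proj p) a) : e.model ⧸ J) := by
  simp only [quotientTrivialization]
  rw [dif_pos hp]
  rfl

theorem quotientTrivialization_ofModel_mk (hp : p ∈ B.sheet e J) (b : e.model) :
    (quotientTrivialization he J).ofModel p (LieSubmodule.Quotient.mk b : e.model ⧸ J) =
      LieSubmodule.Quotient.mk (e.ofModel (B.proj p) b) := by
  simp only [quotientTrivialization]
  rw [dif_pos hp]
  rfl

/-- The pullback of a functional to the model by the projection to the quotient. -/
def quotientDual (J : LieIdeal ℝ e.model)
    (l : Module.Dual ℝ (quotientTrivialization he J).model) : Module.Dual ℝ e.model :=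
  l ∘ₗ (LieSubmodule.Quotient.mk' J : e.model →ₗ[ℝ] e.model ⧸ J)

theorem quotientDual_apply (l : Module.Dual ℝ (quotientTrivialization he J).model)
    (b : e.model) : quotientDual he J l b = l (LieSubmodule.Quotient.mk b : e.model ⧸ J) := rfl

end

variable (B) [IsManifold 𝓘(ℝ, E) ∞ M]

/-- The bundle of Lie algebras with fibres `V x ⧸ I` over the space of maximal ideals. -/
def quotientBundle : LieAlgebraBundle E B.QuotientFibre where
  trivializations := {t | ∃ (e : LieTrivialization V) (he : e ∈ B.trivializations)
    (J : LieIdeal ℝ e.model), t = quotientTrivialization he J}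
  exists_mem_baseSet p := ⟨_, ⟨B.trivAt (B.proj p), B.trivAt_mem _, label _ p, rfl⟩,
    B.mem_baseSet_trivAt _, rfl⟩
  contMDiffOn_transition := by
    rintro _ ⟨e, he, J, rfl⟩ _ ⟨e', he', J', rfl⟩ b l
    obtain ⟨b, rfl⟩ := LieSubmodule.Quotient.surjective_mk' J b
    -- A matrix coefficient of the quotient transition is one of `B`, composed with the projection.
    refine ((B.contMDiffOn_transition e he e' he' b (quotientDual he' J' l)).comp
      (s := B.sheet e J ∩ B.sheet e' J') B.contMDiff_proj.contMDiffOn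
      fun p hp => ⟨hp.1.1, hp.2.1⟩).congr fun p hp => ?_
    erw [quotientTrivialization_ofModel_mk he hp.1, quotientTrivialization_toModel_mk he' hp.2]
    rfl

theorem quotientTrivialization_mem {e : LieTrivialization V} (he : e ∈ B.trivializations)
    (J : LieIdeal ℝ e.model) :
    quotientTrivialization he J ∈ B.quotientBundle.trivializations :=
  ⟨e, he, J, rfl⟩

end LieAlgebraBundle

namespace LieAlgebraBundle

variable {E : Type w} [NormedAddCommGroup E] [NormedSpace ℝ E]
  {M : Type u} [TopologicalSpace M] [ChartedSpace E M] {V : M → Type v}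
  [∀ x, LieRing (V x)] [∀ x, LieAlgebra ℝ (V x)] {B : LieAlgebraBundle E V}

section

variable [IsManifold 𝓘(ℝ, E) ∞ M]

theorem SeminormIndex.norm_iteratedFDeriv_le (i : B.SeminormIndex)
    (σ : B.SmoothSection) {x : M} (hx : x ∈ i.K) :
    ‖iteratedFDeriv ℝ i.n (localRep i.e i.l i.φ σ) (i.φ x)‖ ≤ i.seminorm σ :=
  le_ciSup (i.bddAbove σ) ⟨x, hx⟩

theorem SeminormIndex.seminorm_le (i : B.SeminormIndex)
    (σ : B.SmoothSection) {C : ℝ} (hC : 0 ≤ C)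
    (h : ∀ x ∈ i.K, ‖iteratedFDeriv ℝ i.n (localRep i.e i.l i.φ σ) (i.φ x)‖ ≤ C) :
    i.seminorm σ ≤ C :=
  Real.iSup_le (fun x => h x x.2) hC

end

variable [∀ x, LieAlgebra.IsSemisimple ℝ (V x)]

/-! ### Sections of the bundle of simple quotients -/

theorem eq_of_forall_mk_ideal_eq {σ τ : ∀ x, V x} {x : M}
    (h : ∀ p : B.IdealCover, B.proj p = x →
      (LieSubmodule.Quotient.mk (σ (B.proj p)) : B.QuotientFibre p) =
        LieSubmodule.Quotient.mk (τ (B.proj p))) : σ x = τ x :=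
  LieAlgebra.IsSemisimple.eq_of_forall_mk_eq (R := ℝ) fun I hI =>
    h (MaximalIdealSpace.mk x I hI) rfl

/-- The linear sections of the quotient maps of the model of a trivialisation. -/
theorem exists_forall_toModel_eq_sum {e : LieTrivialization V} (he : e ∈ B.trivializations)
    (hne : e.baseSet.Nonempty) :
    ∃ s : ∀ J : {J : LieIdeal ℝ e.model // IsCoatom J},
        (quotientTrivialization he J.1).model →ₗ[ℝ] e.model,
      ∀ [Fintype {J : LieIdeal ℝ e.model // IsCoatom J}] (σ : ∀ x, V x)
        (τ : ∀ p : B.IdealCover, B.QuotientFibre p),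
        (∀ p, LieSubmodule.Quotient.mk (σ (B.proj p)) = τ p) →
        ∀ x ∈ e.baseSet, ∀ q : {J : LieIdeal ℝ e.model // IsCoatom J} → B.IdealCover,
          (∀ J, q J ∈ B.sheet e J.1) → (∀ J, B.proj (q J) = x) →
          e.toModel x (σ x) = ∑ J, s J ((quotientTrivialization he J.1).toModel (q J) (τ (q J))) := by
  have := e.isSemisimple_model hne
  obtain ⟨s, hs⟩ := LieAlgebra.IsSemisimple.exists_sections_quotient (K := ℝ) e.model
  refine ⟨s, fun {_} σ τ hστ x hx q hq hqx => ?_⟩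
  -- Both sides are compared modulo each maximal ideal `J` of the model: each reduces to the
  -- component at `q J`.
  refine LieAlgebra.IsSemisimple.eq_of_forall_mk_eq (R := ℝ) fun J hJ => ?_
  refine Eq.trans ?_ (hs (fun J => (quotientTrivialization he J.1).toModel (q J) (τ (q J)))
    ⟨J, hJ⟩).symm
  rw [← hστ]
  refine Eq.trans ?_ (quotientTrivialization_toModel_mk he (hq ⟨J, hJ⟩) _).symm
  rw [hqx ⟨J, hJ⟩]

theorem finite_coatoms_model {e : LieTrivialization V} (hne : e.baseSet.Nonempty) :
    Finite {J : LieIdeal ℝ e.model // IsCoatom J} := by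
  have := e.isSemisimple_model hne
  exact LieAlgebra.IsSemisimple.finite_isCoatom (R := ℝ) (L := e.model)

variable (B)

/-- Purely fibrewise surjectivity, from the product decomposition of each `V x`; smoothness is
`isSmoothSection_of_forall_mk_eq`. -/
theorem exists_forall_mk_eq (τ : ∀ p : B.IdealCover, B.QuotientFibre p) :
    ∃ σ : ∀ x, V x, ∀ p, LieSubmodule.Quotient.mk (σ (B.proj p)) = τ p := by
  have h : ∀ x, ∃ a : V x, ∀ I (hI : IsCoatom I),
      (LieSubmodule.Quotient.mk a : V x ⧸ I) = τ (MaximalIdealSpace.mk x I hI) := by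
    intro x
    have : FiniteDimensional ℝ (V x) := LinearEquiv.finiteDimensional
      ((B.trivAt x).equivAt (B.mem_baseSet_trivAt x)).symm.toLinearEquiv
    obtain ⟨s, hs⟩ := LieAlgebra.IsSemisimple.exists_sections_quotient (K := ℝ) (V x)
    have : Finite {I : LieIdeal ℝ (V x) // IsCoatom I} :=
      LieAlgebra.IsSemisimple.finite_isCoatom (R := ℝ) (L := V x)
    have := Fintype.ofFinite {I : LieIdeal ℝ (V x) // IsCoatom I}
    exact ⟨_, fun I hI => hs (fun I => τ (MaximalIdealSpace.mk x I.1 I.2)) ⟨I, hI⟩⟩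
  choose σ hσ using h
  exact ⟨σ, fun p => hσ (B.proj p) p.ideal p.isCoatom_ideal⟩

variable [IsManifold 𝓘(ℝ, E) ∞ M]

/-- The homomorphism from sections of a bundle to sections of the bundle of simple quotients. -/
def quotientSection : B.SmoothSection →ₗ⁅ℝ⁆ B.quotientBundle.SmoothSection where
  toFun σ := ⟨fun p => LieSubmodule.Quotient.mk (σ (B.proj p)), by
    rintro _ ⟨e, he, J, rfl⟩ l
    refine ((σ.isSmooth e he (quotientDual he J l)).comp (s := B.sheet e J)
      B.contMDiff_proj.contMDiffOn fun p hp => hp.1).congr fun p hp => ?_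
    erw [quotientTrivialization_toModel_mk he hp]
    rfl⟩
  map_add' _ _ := rfl
  map_smul' _ _ := rfl
  map_lie' := rfl

theorem injective_quotientSection : Function.Injective B.quotientSection := by
  intro σ τ h
  ext x
  exact eq_of_forall_mk_ideal_eq (B := B) fun p _ =>
    congrArg (fun ρ : B.quotientBundle.SmoothSection => ρ p) h

variable {B} in
-- In a trivialisation, `σ` is the sum over `J` of `s J` applied to `τ` along the smooth local
-- section of the projection given by the sheet of `J`.
theorem isSmoothSection_of_forall_mk_eq {σ : ∀ x, V x} (τ : B.quotientBundle.SmoothSection)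
    (h : ∀ p, LieSubmodule.Quotient.mk (σ (B.proj p)) = τ p) : B.IsSmoothSection σ := by
  intro e he l
  rcases e.baseSet.eq_empty_or_nonempty with hemp | hne
  · rw [hemp]; exact fun x hx => hx.elim
  obtain ⟨s, hs⟩ := exists_forall_toModel_eq_sum he hne
  have := finite_coatoms_model hne
  have := Fintype.ofFinite {J : LieIdeal ℝ e.model // IsCoatom J}
  let S (J : {J : LieIdeal ℝ e.model // IsCoatom J}) : OpenPartialHomeomorph B.IdealCover M :=
    sheetHomeomorph he J.2 (B.lift e J.2 hne.choose_spec)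
  have hsum : ContMDiffOn 𝓘(ℝ, E) 𝓘(ℝ, ℝ) ∞ (fun x => ∑ J, (l ∘ₗ s J)
      ((quotientTrivialization he J.1).toModel ((S J).symm x) (τ ((S J).symm x)))) e.baseSet := by
    refine contMDiffOn_finsetSum fun J _ => ?_
    exact (τ.isSmooth _ (B.quotientTrivialization_mem he J.1) (l ∘ₗ s J)).comp
      (contMDiffOn_sheetHomeomorph_symm he J.2 _) fun x hx => sheetHomeomorph_symm_mem he J.2 _ hx
  refine hsum.congr fun x hx => ?_
  rw [hs σ τ h x hx (fun J => (S J).symm x) (fun J => sheetHomeomorph_symm_mem he J.2 _ hx)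
    fun J => proj_sheetHomeomorph_symm he J.2 _ hx, map_sum]
  rfl

theorem bijective_quotientSection : Function.Bijective B.quotientSection := by
  refine ⟨B.injective_quotientSection, fun τ => ?_⟩
  obtain ⟨σ, hσ⟩ := B.exists_forall_mk_eq τ
  exact ⟨⟨σ, isSmoothSection_of_forall_mk_eq τ hσ⟩, SmoothSection.ext hσ⟩

/-- The isomorphism of the sections of a bundle with the sections of the bundle of simple
quotients. -/
def quotientSectionEquiv : B.SmoothSection ≃ₗ⁅ℝ⁆ B.quotientBundle.SmoothSection :=
  LieEquiv.ofBijective B.quotientSection B.bijective_quotientSection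

@[simp] theorem quotientSectionEquiv_apply (σ : B.SmoothSection) (p : B.IdealCover) :
    B.quotientSectionEquiv σ p = LieSubmodule.Quotient.mk (σ (B.proj p)) := rfl

theorem mk_quotientSectionEquiv_symm_apply (τ : B.quotientBundle.SmoothSection)
    (p : B.IdealCover) :
    LieSubmodule.Quotient.mk (B.quotientSectionEquiv.symm τ (B.proj p)) = τ p :=
  congrArg (fun ρ : B.quotientBundle.SmoothSection => ρ p)
    (B.quotientSectionEquiv.apply_symm_apply τ)

/-! ### Seminorm estimates and continuity in both directions -/

theorem localRep_quotientSection {e : LieTrivialization V} (he : e ∈ B.trivializations)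
    {J : LieIdeal ℝ e.model} (l : Module.Dual ℝ (quotientTrivialization he J).model)
    (σ : B.SmoothSection) {φ : OpenPartialHomeomorph M E}
    {φ' : OpenPartialHomeomorph B.IdealCover E} {y : E} (hy : φ'.symm y ∈ B.sheet e J)
    (h : B.proj (φ'.symm y) = φ.symm y) :
    localRep (quotientTrivialization he J) l φ' (B.quotientSectionEquiv σ) y =
      localRep e (quotientDual he J l) φ σ y := by
  rw [localRep, localRep, ← h, quotientDual_apply, ← quotientTrivialization_toModel_mk he hy]
  rfl

variable {B} in
theorem exists_seminorm_quotientSectionEquiv_le (i : B.quotientBundle.SeminormIndex) :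
    ∃ j : B.SeminormIndex, ∀ σ, i.seminorm (B.quotientSectionEquiv σ) ≤ j.seminorm σ := by
  obtain ⟨_, ⟨e, he, J, rfl⟩, _, ⟨e₂, he₂, J₂, hJ₂, p, φ, hφ, rfl⟩, K, hK, hKφ, hKe, n, l⟩ := i
  let s := sheetHomeomorph he₂ hJ₂ p
  let i : B.quotientBundle.SeminormIndex := ⟨_, B.quotientTrivialization_mem he J, _,
    sheetHomeomorph_trans_mem_atlas he₂ hJ₂ p hφ, K, hK, hKφ, hKe, n, l⟩
  -- The sheet of the chart (`e₂`, `J₂`) may differ from that of the trivialisation (`e`, `J`). Only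
  -- `φ` survives of the chart, since coordinates upstairs are coordinates of the projection.
  let j : B.SeminormIndex := ⟨e, he, φ, hφ, B.proj '' K, hK.image B.continuous_proj, by
    rintro _ ⟨q, hq, rfl⟩
    have := hKφ hq
    rw [OpenPartialHomeomorph.trans_source] at this
    exact this.2, by
    rintro _ ⟨q, hq, rfl⟩
    exact (hKe hq).1, n, quotientDual he J l⟩
  refine ⟨j, fun σ => i.seminorm_le _ (apply_nonneg _ _) fun q hq => ?_⟩
  refine le_trans (le_of_eq ?_) (j.norm_iteratedFDeriv_le σ (Set.mem_image_of_mem _ hq))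
  have hev : localRep i.e i.l i.φ (B.quotientSectionEquiv σ) =ᶠ[𝓝 (i.φ q)]
      localRep j.e j.l j.φ σ := by
    filter_upwards [i.isOpen.mem_nhds (i.mem hq)] with y hy
    exact B.localRep_quotientSection he l σ hy.2 (proj_sheetHomeomorph_trans_symm hy.1)
  rw [(Filter.EventuallyEq.iteratedFDeriv ℝ hev i.n).eq_of_nhds]
  rfl

theorem continuous_quotientSectionEquiv : Continuous B.quotientSectionEquiv := by
  refine SmoothSection.withSeminorms.continuous_of_continuous_comp
    (B.quotientSectionEquiv : B.SmoothSection →ₗ[ℝ] B.quotientBundle.SmoothSection) ?_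
  intro i
  obtain ⟨j, hj⟩ := exists_seminorm_quotientSectionEquiv_le i
  exact Seminorm.continuous_of_le (SmoothSection.withSeminorms.continuous_seminorm j) hj

variable {B} in
-- Near `K` the coordinate expression downstairs is the sum over the sheets of those of `τ`, with
-- functionals `i.l ∘ₗ s J`; the bound is the corresponding finite sum of seminorms.
theorem exists_seminorm_quotientSectionEquiv_symm_le (i : B.SeminormIndex) :
    ∃ q : Seminorm ℝ B.quotientBundle.SmoothSection, Continuous q ∧
      ∀ τ, i.seminorm (B.quotientSectionEquiv.symm τ) ≤ q τ := by
  rcases i.K.eq_empty_or_nonempty with hemp | ⟨x₀, hx₀⟩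
  · exact ⟨0, continuous_const, fun τ => i.seminorm_le _ le_rfl fun x hx => by simp [hemp] at hx⟩
  have hne : i.e.baseSet.Nonempty := ⟨x₀, i.K_subset_baseSet hx₀⟩
  obtain ⟨s, hs⟩ := exists_forall_toModel_eq_sum i.he hne
  have := finite_coatoms_model hne
  have := Fintype.ofFinite {J : LieIdeal ℝ i.e.model // IsCoatom J}
  let S (J : {J : LieIdeal ℝ i.e.model // IsCoatom J}) : OpenPartialHomeomorph B.IdealCover M :=
    sheetHomeomorph i.he J.2 (B.lift i.e J.2 hne.choose_spec)
  have hS (J) : (S J).target = i.e.baseSet := rfl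
  -- The data of `i` lifted to the sheet of `J`.
  let j (J : {J : LieIdeal ℝ i.e.model // IsCoatom J}) : B.quotientBundle.SeminormIndex :=
    ⟨_, B.quotientTrivialization_mem i.he J.1, _,
      sheetHomeomorph_trans_mem_atlas i.he J.2 (B.lift i.e J.2 hne.choose_spec) i.hφ,
      (S J).symm '' i.K,
      i.isCompact_K.image_of_continuousOn ((S J).continuousOn_symm.mono i.K_subset_baseSet), by
        rintro _ ⟨x, hx, rfl⟩
        have hx' := i.K_subset_baseSet hx
        rw [OpenPartialHomeomorph.trans_source]
        refine ⟨sheetHomeomorph_symm_mem _ _ _ hx', ?_⟩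
        have h1 : B.proj ((S J).symm x) = x := proj_sheetHomeomorph_symm _ _ _ hx'
        change B.proj ((S J).symm x) ∈ i.φ.source
        rw [h1]
        exact i.K_subset_source hx, by
        rintro _ ⟨x, hx, rfl⟩
        exact sheetHomeomorph_symm_mem _ _ _ (i.K_subset_baseSet hx), i.n, i.l ∘ₗ s J⟩
  have hproj : ∀ J, ∀ x ∈ i.e.baseSet, B.proj ((S J).symm x) = x := fun J x hx =>
    proj_sheetHomeomorph_symm _ _ _ hx
  refine ⟨∑ J, (j J).seminorm, Seminorm.continuous_finsetSum fun J _ =>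
    SmoothSection.withSeminorms.continuous_seminorm (j J), fun τ => ?_⟩
  refine i.seminorm_le _ (apply_nonneg _ _) fun x hx => ?_
  have hφx : ∀ J, (j J).φ ((S J).symm x) = i.φ x := fun J =>
    congrArg i.φ (hproj J x (i.K_subset_baseSet hx))
  have hmem : ∀ J, (S J).symm x ∈ (j J).K := fun J => Set.mem_image_of_mem _ hx
  have hev : localRep i.e i.l i.φ (B.quotientSectionEquiv.symm τ) =ᶠ[𝓝 (i.φ x)]
      fun y => ∑ J, localRep (j J).e (j J).l (j J).φ τ y := by
    filter_upwards [i.isOpen.mem_nhds (i.mem hx)] with y hy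
    rw [localRep, hs _ τ (B.mk_quotientSectionEquiv_symm_apply τ) _ hy.2
      (fun J => (S J).symm (i.φ.symm y)) (fun J => sheetHomeomorph_symm_mem i.he J.2 _ hy.2)
      fun J => hproj J _ hy.2, map_sum]
    rfl
  have hsum : (∑ J, (j J).seminorm) τ = ∑ J, (j J).seminorm τ := by
    change FunLike.coeAddMonoidHom _ _ _ (∑ J, (j J).seminorm) τ = _
    rw [map_sum, Finset.sum_apply]
    rfl
  have hn : ((i.n : ℕ∞) : WithTop ℕ∞) ≤ ∞ := by exact_mod_cast le_top
  rw [(Filter.EventuallyEq.iteratedFDeriv ℝ hev i.n).eq_of_nhds, iteratedFDeriv_fun_sum_apply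
    fun J _ => hφx J ▸ ((j J).contDiffAt τ (hmem J)).of_le hn, hsum]
  refine (norm_sum_le _ _).trans (Finset.sum_le_sum fun J _ => ?_)
  have := (j J).norm_iteratedFDeriv_le τ (hmem J)
  rwa [hφx J] at this

theorem continuous_quotientSectionEquiv_symm : Continuous B.quotientSectionEquiv.symm := by
  refine SmoothSection.withSeminorms.continuous_of_continuous_comp
    (B.quotientSectionEquiv.symm : B.quotientBundle.SmoothSection →ₗ[ℝ] B.SmoothSection) ?_
  intro i
  obtain ⟨q, hq, hle⟩ := exists_seminorm_quotientSectionEquiv_symm_le i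
  exact Seminorm.continuous_of_le hq hle

end LieAlgebraBundle

namespace LieAlgebraBundle

/-! ### Homomorphisms between algebras of compactly supported sections -/

section CompactSectionMap

variable {E E' : Type*} [NormedAddCommGroup E] [NormedSpace ℝ E]
  [NormedAddCommGroup E'] [NormedSpace ℝ E']
  {M M' : Type*} [TopologicalSpace M] [ChartedSpace E M] [TopologicalSpace M'] [ChartedSpace E' M']
  {V : M → Type*} [∀ x, LieRing (V x)] [∀ x, LieAlgebra ℝ (V x)]
  {V' : M' → Type*} [∀ x, LieRing (V' x)] [∀ x, LieAlgebra ℝ (V' x)]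
  {B : LieAlgebraBundle E V} {B' : LieAlgebraBundle E' V'}

/-- A map between sections preserves compact supports if it maps the sections vanishing outside a
compact set to sections vanishing outside another compact set. -/
def PreservesCompactSupport (f : B.SmoothSection → B'.SmoothSection) : Prop :=
  ∀ K : Set M, IsCompact K → ∃ K' : Set M', IsCompact K' ∧
    ∀ σ : B.SmoothSection, (∀ x ∉ K, σ x = 0) → ∀ x ∉ K', f σ x = 0

/-- The restriction to compactly supported sections of a homomorphism preserving compact
supports. -/
def compactSectionMap (f : B.SmoothSection →ₗ⁅ℝ⁆ B'.SmoothSection)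
    (hf : PreservesCompactSupport f) : B.CompactSection →ₗ⁅ℝ⁆ B'.CompactSection where
  toFun σ := ⟨f σ.toSmoothSection, by
    obtain ⟨K, hK, h⟩ := σ.2
    obtain ⟨K', hK', h'⟩ := hf K hK
    exact ⟨K', hK', h' _ h⟩⟩
  map_add' σ τ := Subtype.ext (f.map_add σ.toSmoothSection τ.toSmoothSection)
  map_smul' c σ := Subtype.ext (f.map_smul c σ.toSmoothSection)
  map_lie' {σ τ} := Subtype.ext (f.map_lie σ.toSmoothSection τ.toSmoothSection)

variable [IsManifold 𝓘(ℝ, E) ∞ M] [IsManifold 𝓘(ℝ, E') ∞ M']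

variable (B) in
theorem inductiveLimitTop_le :
    CompactSection.inductiveLimitTop B ≤ (inferInstance : TopologicalSpace B.CompactSection) :=
  le_sInf fun _ ht => ht.1

/-- The target topology pulled back along the map is a locally convex vector topology, so by the
universal property it suffices to treat each `Γ_K`. There the map factors through a single `Γ_K'`,
since `K'` depends on `K` alone. -/
theorem continuous_compactSectionMap {f : B.SmoothSection →ₗ⁅ℝ⁆ B'.SmoothSection}
    (hc : Continuous f) (hf : PreservesCompactSupport f) :
    Continuous (compactSectionMap f hf) := by
  rw [continuous_iff_le_induced]
  refine sInf_le ⟨iSup_le fun K => ?_, ?_, ?_, ?_⟩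
  · rw [coinduced_le_iff_le_induced, induced_compose]
    obtain ⟨K', hK', h'⟩ := hf K K.isCompact
    let g : {σ : B.CompactSection // ∀ x ∉ K, σ x = 0} →
        {σ : B'.CompactSection // ∀ x ∉ (⟨K', hK'⟩ : TopologicalSpace.Compacts M'), σ x = 0} :=
      fun σ => ⟨compactSectionMap f hf σ.1, h' _ σ.2⟩
    let t : TopologicalSpace {σ : B.CompactSection // ∀ x ∉ K, σ x = 0} :=
      TopologicalSpace.induced (fun σ => σ.1.toSmoothSection) inferInstance
    let t' : TopologicalSpace {σ : B'.CompactSection //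
        ∀ x ∉ (⟨K', hK'⟩ : TopologicalSpace.Compacts M'), σ x = 0} :=
      TopologicalSpace.induced (fun σ => σ.1.toSmoothSection) inferInstance
    have hg : Continuous g := continuous_induced_rng.2 (hc.comp continuous_induced_dom)
    have hv : Continuous (Subtype.val : {σ : B'.CompactSection //
        ∀ x ∉ (⟨K', hK'⟩ : TopologicalSpace.Compacts M'), σ x = 0} → B'.CompactSection) :=
      continuous_iff_coinduced_le.2 ((le_iSup (fun K : TopologicalSpace.Compacts M' =>
        TopologicalSpace.coinduced
          (Subtype.val : {σ : B'.CompactSection // ∀ x ∉ K, σ x = 0} → B'.CompactSection)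
          (TopologicalSpace.induced (fun σ => σ.1.toSmoothSection) inferInstance)) _).trans
        (inductiveLimitTop_le B'))
    exact continuous_iff_le_induced.1 (hv.comp hg)
  · exact topologicalAddGroup_induced (compactSectionMap f hf)
  · exact continuousSMul_induced (compactSectionMap f hf : B.CompactSection →ₗ[ℝ] B'.CompactSection)
  · exact LocallyConvexSpace.induced
      (compactSectionMap f hf : B.CompactSection →ₗ[ℝ] B'.CompactSection)

/-- The isomorphism of algebras of compactly supported sections induced by an isomorphism of
algebras of sections. -/
def compactSectionEquiv (f : B.SmoothSection ≃ₗ⁅ℝ⁆ B'.SmoothSection)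
    (hf : PreservesCompactSupport f) (hf' : PreservesCompactSupport f.symm) :
    B.CompactSection ≃ₗ⁅ℝ⁆ B'.CompactSection where
  __ := compactSectionMap f.toLieHom hf
  invFun := compactSectionMap f.symm.toLieHom hf'
  left_inv σ := Subtype.ext (f.symm_apply_apply σ.toSmoothSection)
  right_inv σ := Subtype.ext (f.apply_symm_apply σ.toSmoothSection)

end CompactSectionMap

section Quotient

variable {E : Type w} [NormedAddCommGroup E] [NormedSpace ℝ E]
  {M : Type u} [TopologicalSpace M] [ChartedSpace E M] {V : M → Type v}
  [∀ x, LieRing (V x)] [∀ x, LieAlgebra ℝ (V x)] (B : LieAlgebraBundle E V)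
  [∀ x, LieAlgebra.IsSemisimple ℝ (V x)]

/-- A section vanishes at `x` once all its components over `x` do, so the projection of `K` works.
-/
theorem preservesCompactSupport_quotientSectionEquiv_symm [IsManifold 𝓘(ℝ, E) ∞ M] :
    PreservesCompactSupport B.quotientSectionEquiv.symm := by
  refine fun K hK => ⟨_, hK.image B.continuous_proj, fun τ hτ x hx => ?_⟩
  refine eq_of_forall_mk_ideal_eq (B := B) (σ := B.quotientSectionEquiv.symm τ) (τ := 0) ?_
  intro p hp
  rw [mk_quotientSectionEquiv_symm_apply, hτ p fun h => hx ⟨p, h, hp⟩]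
  rfl

variable [FiniteDimensional ℝ E] [T2Space M]

/-- Over a small compact neighbourhood the cover is the union of the images of finitely many local
sections. Compactness of `K` patches these into a compact set containing the closed preimage. -/
theorem isCompact_preimage_proj {K : Set M} (hK : IsCompact K) : IsCompact (B.proj ⁻¹' K) := by
  have : LocallyCompactSpace M := Manifold.locallyCompact_of_finiteDimensional 𝓘(ℝ, E)
  obtain ⟨C, hC, hKC⟩ : ∃ C : Set B.IdealCover, IsCompact C ∧ B.proj ⁻¹' K ⊆ C := by
    refine hK.induction_on (p := fun S => ∃ C : Set B.IdealCover, IsCompact C ∧ B.proj ⁻¹' S ⊆ C)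
      ⟨∅, isCompact_empty, by simp⟩ (fun S T hST ⟨C, hC, h⟩ => ⟨C, hC, fun p hp => h (hST hp)⟩)
      (fun S T ⟨C, hC, h⟩ ⟨D, hD, h'⟩ => ⟨C ∪ D, hC.union hD, Set.union_subset_union h h'⟩) ?_
    intro x _
    let e := B.trivAt x
    have hx : x ∈ e.baseSet := B.mem_baseSet_trivAt x
    obtain ⟨N, hN, hNe, hNc⟩ := local_compact_nhds (e.isOpen_baseSet.mem_nhds hx)
    have : Finite {J : LieIdeal ℝ e.model // IsCoatom J} := finite_coatoms_model ⟨x, hx⟩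
    refine ⟨N, mem_nhdsWithin_of_mem_nhds hN, ⋃ J : {J : LieIdeal ℝ e.model // IsCoatom J},
      (sheetHomeomorph (B.trivAt_mem x) J.2 (B.lift e J.2 hx)).symm '' N,
      isCompact_iUnion fun J => hNc.image_of_continuousOn
        ((OpenPartialHomeomorph.continuousOn_symm _).mono hNe), fun p hp => ?_⟩
    have hpe : B.proj p ∈ e.baseSet := hNe hp
    exact Set.mem_iUnion.2 ⟨⟨label e p, isCoatom_label e hpe⟩, B.proj p, hp,
      (sheetHomeomorph (B.trivAt_mem x) (isCoatom_label e hpe) _).left_inv ⟨hpe, rfl⟩⟩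
  exact hC.of_isClosed_subset (hK.isClosed.preimage B.continuous_proj) hKC

variable [IsManifold 𝓘(ℝ, E) ∞ M]

theorem preservesCompactSupport_quotientSectionEquiv :
    PreservesCompactSupport B.quotientSectionEquiv := by
  refine fun K hK => ⟨_, B.isCompact_preimage_proj hK, fun σ hσ p hp => ?_⟩
  rw [quotientSectionEquiv_apply, hσ _ hp]
  rfl

theorem exists_compactSectionEquiv :
    ∃ Φ : B.CompactSection ≃ₗ⁅ℝ⁆ B.quotientBundle.CompactSection, Continuous Φ ∧
      Continuous Φ.symm ∧ ∀ σ p, Φ σ p = LieSubmodule.Quotient.mk (σ (B.proj p)) :=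
  ⟨compactSectionEquiv B.quotientSectionEquiv B.preservesCompactSupport_quotientSectionEquiv
      B.preservesCompactSupport_quotientSectionEquiv_symm,
    continuous_compactSectionMap (f := B.quotientSectionEquiv.toLieHom)
      B.continuous_quotientSectionEquiv B.preservesCompactSupport_quotientSectionEquiv,
    continuous_compactSectionMap (f := B.quotientSectionEquiv.symm.toLieHom)
      B.continuous_quotientSectionEquiv_symm B.preservesCompactSupport_quotientSectionEquiv_symm,
    fun σ p => B.quotientSectionEquiv_apply σ.toSmoothSection p⟩

end Quotient

end LieAlgebraBundle

end

theorem theorem3p1 {E : Type w} [NormedAddCommGroup E] [NormedSpace ℝ E] [FiniteDimensional ℝ E]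
    {M : Type u} [TopologicalSpace M] [T2Space M] [SecondCountableTopology M]
    [ChartedSpace E M] [IsManifold 𝓘(ℝ, E) ∞ M]
    {V : M → Type v} [∀ x, LieRing (V x)] [∀ x, LieAlgebra ℝ (V x)]
    (B : LieAlgebraBundle E V) (hss : ∀ x, LieAlgebra.IsSemisimple ℝ (V x)) :
    -- the points of the finite cover are the maximal ideals of the fibres
    ∃ (_ : TopologicalSpace (MaximalIdealSpace V)) (_ : ChartedSpace E (MaximalIdealSpace V))
      (_ : IsManifold 𝓘(ℝ, E) ∞ (MaximalIdealSpace V)),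
      T2Space (MaximalIdealSpace V) ∧ SecondCountableTopology (MaximalIdealSpace V) ∧
      -- the projection to `M` is a smooth finite covering
      IsCoveringMap (MaximalIdealSpace.base : MaximalIdealSpace V → M) ∧
      (∀ x : M, ((MaximalIdealSpace.base : MaximalIdealSpace V → M) ⁻¹' {x}).Finite) ∧
      (∀ x : M, Nontrivial (V x) →
        ((MaximalIdealSpace.base : MaximalIdealSpace V → M) ⁻¹' {x}).Nonempty) ∧
      IsLocalDiffeomorph 𝓘(ℝ, E) 𝓘(ℝ, E) ∞ (MaximalIdealSpace.base : MaximalIdealSpace V → M) ∧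
      -- a Lie algebra bundle over it with fibres `V x ⧸ I`, which are simple
      ∃ B' : LieAlgebraBundle E (fun p : MaximalIdealSpace V => V p.base ⧸ p.ideal),
        (∀ p : MaximalIdealSpace V, LieAlgebra.IsSimple ℝ (V p.base ⧸ p.ideal)) ∧
        -- isomorphisms of locally convex Lie algebras
        (∃ Φ : B.SmoothSection ≃ₗ⁅ℝ⁆ B'.SmoothSection,
          Continuous Φ ∧ Continuous Φ.symm ∧
          ∀ σ p, Φ σ p = LieSubmodule.Quotient.mk (σ p.base)) ∧
        (∃ Φc : B.CompactSection ≃ₗ⁅ℝ⁆ B'.CompactSection,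
          Continuous Φc ∧ Continuous Φc.symm ∧
          ∀ σ p, Φc σ p = LieSubmodule.Quotient.mk (σ p.base)) := by

  refine ⟨(inferInstance : TopologicalSpace B.IdealCover),
    (inferInstance : ChartedSpace E B.IdealCover),
    (inferInstance : IsManifold 𝓘(ℝ, E) ∞ B.IdealCover),
    (inferInstance : T2Space B.IdealCover), (inferInstance : SecondCountableTopology B.IdealCover),
    B.isCoveringMap_proj, B.finite_preimage_proj, fun x _ => B.nonempty_preimage_proj x,
    B.isLocalDiffeomorph_proj, B.quotientBundle,
    fun p => LieAlgebra.IsSemisimple.isSimple_quotient_of_isCoatom p.isCoatom_ideal,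
    ⟨B.quotientSectionEquiv, B.continuous_quotientSectionEquiv,
      B.continuous_quotientSectionEquiv_symm, B.quotientSectionEquiv_apply⟩, B.exists_compactSectionEquiv⟩
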